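/- Let $V$ be a finite set of vertices, each vertex $v$ having a colour $c(v)$. Call a set $F\subseteq V$ fair (for $\alpha=1/2$) if each colour occurs on at most $|F|/2$ vertices of $F$. A fairlet decomposition is a partition of $V$ into nonempty fair sets (fairlets). For a map $\phi:V\to M$ into a (pseudo)metric space $(M,d)$, write $d(u,v)=d(\phi(u),\phi(v))$ for $u,v\in V$, and let the median cost of a partition $\mathcal P$ be $\mathrm{mcost}(\mathcal P)=\sum_{P\in\mathcal P}\inf_{m\in M}\sum_{v\in P}d(m,\phi(v))$. Let $H$ be the graph on $V$ in which $u,v$ are adjacent if and only if $c(u)\ne c(v)$, the edge $uv$ having weight $d(u,v)$. A $2$-factor of $H$ is an assignment of multiplicities in $\mathbb N$ to the edges of $H$ such that every vertex has degree exactly $2$; it is a disjoint union of cycles covering $V$, an edge of multiplicity $2$ being a cycle of length $2$. A rounding of a $2$-factor is a partition of $V$ obtained by cutting every cycle of even length into alternating edges, and every cycle of odd length into one set of three consecutive vertices of pairwise distinct colours and alternating edges covering the remaining vertices. (1) If $V$ has a fairlet decomposition, then $H$ has a $2$-factor of minimum weight. Every $2$-factor of $H$ has a rounding. Every rounding $\mathcal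 P$ of every minimum-weight $2$-factor of $H$ is a fairlet decomposition in which every fairlet has size $2$ or $3$, and $\mathrm{mcost}(\mathcal P)\le 2\,\mathrm{mcost}(\mathcal P^*)$ for every fairlet decomposition $\mathcal P^*$, in particular for an optimal one. (2) There is a polynomial-time algorithm for this task on correlation clustering instances. Namely, let an instance consist of $n$ vertices, a partition of the pairs of distinct vertices into positive edges $E^+$ and negative edges, and a colouring of the vertices by natural numbers. Let $M=[0,1]^V$ with the $\ell^1$ distance, and let $\phi(u)_v=1$ if $u=v$ or $uv\in E^+$, and $\phi(u)_v=0$ otherwise. There are a random-access program (with unit-cost addition, truncated subtraction, comparison and array access on natural numbers) and a polynomial $q$ such that on every instance with $n$ vertices the program halts after at most $q(n)$ steps and, whenever the instance has a fairlet decomposition, outputs a rounding $\mathcal P$ of a minimum-weight $2$-factor of $H$; thus $\mathcal P$ is a fairlet decomposition with all fairlets of size $2$ or $3$ and $\mathrm{mcost}(\mathcal P)\le 2\,\mathrm{mcost}(\mathcal P^*)$ for every fairlet decomposition $\mathcal P^*$. -/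

import Mathlib

namespace FairClustering

/-! ### Fairlet decompositions and their median cost -/

section Decomposition

variable {V κ M : Type*}

/-- A set of vertices is `α`-fair for the colouring `c` if every colour makes up at most an
`α`-fraction of it. -/
def IsFair (α : ℝ) (c : V → κ) (p : Finset V) : Prop :=
  ∀ k : κ, (({v : V | v ∈ p ∧ c v = k}.ncard : ℕ) : ℝ) ≤ α * (p.card : ℝ)

variable [Fintype V] [DecidableEq V]

/-- A fairlet decomposition: a partition of the vertex set into (nonempty) `α`-fair sets. -/
def IsFairletDecomposition (α : ℝ) (c : V → κ) (P : Finpartition (Finset.univ : Finset V)) : Prop :=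
  ∀ p ∈ P.parts, IsFair α c p

variable [PseudoMetricSpace M]

/-- The median cost of one set of vertices: the least total distance to a common center in `M`,
where the vertices are placed in `M` by the map `φ`. -/
noncomputable def mcostPart (φ : V → M) (p : Finset V) : ℝ :=
  ⨅ m : M, ∑ v ∈ p, dist m (φ v)

/-- The median cost of a partition. -/
noncomputable def mcost (φ : V → M) (P : Finpartition (Finset.univ : Finset V)) : ℝ :=
  ∑ p ∈ P.parts, mcostPart φ p

/-- The guarantee for a decomposition `P`, for `α = 1/2`: it is a fairlet decomposition, its
fairlets have two or three elements, and its median cost is at most twice that of any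
fairlet decomposition, hence at most twice the optimum. -/
def IsGoodDecomposition (c : V → κ) (φ : V → M) (P : Finpartition (Finset.univ : Finset V)) :
    Prop :=
  IsFairletDecomposition (1 / 2) c P ∧
  (∀ p ∈ P.parts, 2 ≤ p.card ∧ p.card ≤ 3) ∧
  ∀ Q : Finpartition (Finset.univ : Finset V),
    IsFairletDecomposition (1 / 2) c Q → mcost φ P ≤ 2 * mcost φ Q

end Decomposition

/-! ### Minimum-weight 2-factors in the bichromatic graph, and their rounding -/

section TwoFactor

variable {V κ M : Type*}

/-- The bichromatic graph `H`: two vertices are adjacent if their colours differ. -/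
def bichromaticGraph (c : V → κ) : SimpleGraph V where
  Adj u v := c u ≠ c v
  symm := ⟨fun _ _ h => h.symm⟩
  loopless := ⟨fun _ h => h rfl⟩

variable [Fintype V] [DecidableEq V]

/-- A 2-factor of `H`, where edges may be used multiple times: `x e` is the multiplicity of `e`,
only edges of `H` are used, and every vertex has degree 2. -/
def IsTwoFactor (c : V → κ) (x : Sym2 V → ℕ) : Prop :=
  (∀ e : Sym2 V, x e ≠ 0 → e ∈ (bichromaticGraph c).edgeSet) ∧
  ∀ v : V, ∑ u : V, x s(v, u) = 2

/-- The weight of the edge `uv` is the distance between `u` and `v`. -/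
noncomputable def edgeWeight [PseudoMetricSpace M] (φ : V → M) : Sym2 V → ℝ :=
  Sym2.lift ⟨fun u v => dist (φ u) (φ v), fun u v => dist_comm (φ u) (φ v)⟩

/-- The total weight of a 2-factor, with multiplicities. -/
noncomputable def twoFactorCost [PseudoMetricSpace M] (φ : V → M) (x : Sym2 V → ℕ) : ℝ :=
  ∑ e : Sym2 V, (x e : ℝ) * edgeWeight φ e

/-- A 2-factor of `H` of minimum weight. -/
def IsOptimalTwoFactor [PseudoMetricSpace M] (c : V → κ) (φ : V → M) (x : Sym2 V → ℕ) : Prop :=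
  IsTwoFactor c x ∧ ∀ y : Sym2 V → ℕ, IsTwoFactor c y → twoFactorCost φ x ≤ twoFactorCost φ y

/-- The graph of the edges used by `x`. For a 2-factor, its connected components are the cycles
of the 2-factor; an edge of multiplicity 2 is a cycle of length 2. -/
def supportGraph (x : Sym2 V → ℕ) : SimpleGraph V :=
  SimpleGraph.fromEdgeSet {e | x e ≠ 0}

/-- `P` is a possible result of cutting the cycles of the 2-factor `x` into fairlets: every part
is an edge of a cycle, or consists of three consecutive vertices of a cycle that have pairwise
distinct colours; a cycle of even length contains no part of the second kind (so it is cut into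
alternating edges), and a cycle of odd length contains exactly one (so the remaining vertices are
covered by alternating edges). -/
def IsRounding (c : V → κ) (x : Sym2 V → ℕ) (P : Finpartition (Finset.univ : Finset V)) : Prop :=
  (∀ p ∈ P.parts,
    (∃ u v : V, x s(u, v) ≠ 0 ∧ p = {u, v}) ∨
    (∃ u v w : V, x s(u, v) ≠ 0 ∧ x s(v, w) ≠ 0 ∧
      c u ≠ c v ∧ c v ≠ c w ∧ c u ≠ c w ∧ p = {u, v, w})) ∧
  ∀ K : (supportGraph x).ConnectedComponent,
    {p : Finset V | p ∈ P.parts ∧ p.card = 3 ∧ (p : Set V) ⊆ K.supp}.ncard = K.supp.ncard % 2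

end TwoFactor

/-! ### The metric of a correlation clustering instance -/

section Correlation

variable {V : Type*} [Fintype V]

/-- The cube `[0,1]^V` with the `ℓ¹` distance `|x - y| = ∑ v, |x v - y v|`, which is the Hamming
distance on 0/1 vectors. -/
abbrev Cube (V : Type*) [Fintype V] : Type _ :=
  {x : PiLp 1 (fun _ : V => ℝ) // ∀ v, 0 ≤ x v ∧ x v ≤ 1}

open Classical in
/-- An unweighted correlation clustering instance is given by the graph `G` of its positive edges;
all other pairs of distinct vertices are negative edges. The vertex `u` is placed at the `u`-th row
of the adjacency matrix of `G` with a positive self-loop added at every vertex. -/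
noncomputable def embedding (G : SimpleGraph V) (u : V) : Cube V :=
  ⟨WithLp.toLp 1 (fun v => if u = v ∨ G.Adj u v then (1 : ℝ) else 0), fun v => by
    change 0 ≤ (if u = v ∨ G.Adj u v then (1 : ℝ) else 0) ∧
      (if u = v ∨ G.Adj u v then (1 : ℝ) else 0) ≤ 1
    split_ifs <;> norm_num⟩

end Correlation

/-! ### A machine model with a step count

Random-access programs over natural-number variables and two-dimensional arrays of natural numbers
(each program mentions only finitely many of them). Every evaluated operation costs one step. The arithmetic
operations are addition and truncated subtraction only, so that a polynomial number of steps
is polynomial time in the usual sense. -/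

section Machine

/-- Expressions: constants, variables, array entries `a[i, j]`, sums, truncated differences and
the tests `<`, `=` (with value 1 if true and 0 if false). -/
inductive Expr where
  | const (k : ℕ)
  | var (x : ℕ)
  | get (a : ℕ) (i j : Expr)
  | add (e f : Expr)
  | sub (e f : Expr)
  | lt (e f : Expr)
  | eq (e f : Expr)

/-- Commands: no operation, assignment to a variable, to an array entry `a[i, j]`, composition,
conditional and while loop. A value counts as true if it is nonzero. -/
inductive Cmd where
  | skip
  | assign (x : ℕ) (e : Expr)
  | store (a : ℕ) (i j e : Expr)
  | seq (A B : Cmd)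
  | ite (b : Expr) (A B : Cmd)
  | loop (b : Expr) (A : Cmd)

/-- A memory state: the values of the variables and of the array entries. -/
structure State where
  var : ℕ → ℕ
  arr : ℕ → ℕ → ℕ → ℕ

/-- The value of an expression. -/
def Expr.eval (s : State) : Expr → ℕ
  | .const k => k
  | .var x => s.var x
  | .get a i j => s.arr a (i.eval s) (j.eval s)
  | .add e f => e.eval s + f.eval s
  | .sub e f => e.eval s - f.eval s
  | .lt e f => if e.eval s < f.eval s then 1 else 0
  | .eq e f => if e.eval s = f.eval s then 1 else 0

/-- The number of steps needed to evaluate an expression: its number of operations. -/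
def Expr.cost : Expr → ℕ
  | .const _ => 1
  | .var _ => 1
  | .get _ i j => i.cost + j.cost + 1
  | .add e f => e.cost + f.cost + 1
  | .sub e f => e.cost + f.cost + 1
  | .lt e f => e.cost + f.cost + 1
  | .eq e f => e.cost + f.cost + 1

/-- Change the value of one variable. -/
def State.setVar (s : State) (x k : ℕ) : State :=
  { s with var := fun y => if y = x then k else s.var y }

/-- Change the value of one array entry. -/
def State.setArr (s : State) (a i j k : ℕ) : State :=
  { s with arr := fun b i' j' => if b = a ∧ i' = i ∧ j' = j then k else s.arr b i' j' }

/-- `Exec A s t s'`: the program `A`, started in the state `s`, halts after exactly `t` steps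
in the state `s'`. -/
inductive Exec : Cmd → State → ℕ → State → Prop
  | skip (s : State) : Exec .skip s 1 s
  | assign (s : State) (x : ℕ) (e : Expr) :
      Exec (.assign x e) s (e.cost + 1) (s.setVar x (e.eval s))
  | store (s : State) (a : ℕ) (i j e : Expr) :
      Exec (.store a i j e) s (i.cost + j.cost + e.cost + 1)
        (s.setArr a (i.eval s) (j.eval s) (e.eval s))
  | seq {A B : Cmd} {s s' s'' : State} {t t' : ℕ} :
      Exec A s t s' → Exec B s' t' s'' → Exec (.seq A B) s (t + t') s''
  | iteTrue {b : Expr} {A B : Cmd} {s s' : State} {t : ℕ} :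
      b.eval s ≠ 0 → Exec A s t s' → Exec (.ite b A B) s (b.cost + 1 + t) s'
  | iteFalse {b : Expr} {A B : Cmd} {s s' : State} {t : ℕ} :
      b.eval s = 0 → Exec B s t s' → Exec (.ite b A B) s (b.cost + 1 + t) s'
  | loopTrue {b : Expr} {A : Cmd} {s s' s'' : State} {t t' : ℕ} :
      b.eval s ≠ 0 → Exec A s t s' → Exec (.loop b A) s' t' s'' →
        Exec (.loop b A) s (b.cost + 1 + t + t') s''
  | loopFalse {b : Expr} {A : Cmd} {s : State} :
      b.eval s = 0 → Exec (.loop b A) s (b.cost + 1) s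

open Classical in
/-- The input for the instance with vertices `0, …, n - 1`, positive edges `G` and colouring `c`:
variable 0 holds `n`, array 0 is the adjacency matrix of `G`, the first column of array 1 lists the
colours, and all other memory is 0. -/
noncomputable def inputState {n : ℕ} (G : SimpleGraph (Fin n)) (c : Fin n → ℕ) : State where
  var x := if x = 0 then n else 0
  arr a i j :=
    if a = 0 then (if ∃ (hi : i < n) (hj : j < n), G.Adj ⟨i, hi⟩ ⟨j, hj⟩ then 1 else 0)
    else if a = 1 ∧ j = 0 then (if hi : i < n then c ⟨i, hi⟩ else 0)
    else 0

/-- The state `s` outputs the partition `P`: the first column of array 2 holds a label for every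
vertex, and two vertices are in the same part if and only if they have the same label. -/
def Outputs {n : ℕ} (s : State) (P : Finpartition (Finset.univ : Finset (Fin n))) : Prop :=
  ∀ u v : Fin n, (∃ p ∈ P.parts, u ∈ p ∧ v ∈ p) ↔ s.arr 2 u 0 = s.arr 2 v 0

end Machine

end FairClustering

/-! The approximation factor comes from comparing both sides with the weight of a 2-factor. A
rounding costs at most the weight of its 2-factor: the centre of a part is put at an endpoint of the
edge or at the middle vertex of the triple, and different parts use different edges
(`IsRounding.mcost_le`). Conversely, in a fair set no colour occupies more than half of the
vertices, so Hall's theorem gives a permutation σ that preserves the fairlets of Q and changes every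
colour (`IsFairletDecomposition.exists_perm`). The edges {v, σ v} form a 2-factor, and the triangle
inequality through the centres bounds its weight by twice the cost of Q, since σ permutes each
fairlet (`twoFactorCost_permFactor_le`).

Roundings are also constructed through permutations. Hall's theorem gives a permutation σ along the
edges of any 2-factor. An odd cycle of σ has a vertex whose two neighbours differ in colour, since
otherwise colours would repeat with period two around an odd cycle. Cutting the cycle from that
vertex gives one three-coloured triple and edges. The cycles of σ may subdivide an even cycle of the
2-factor, but an odd cycle of σ already uses up both degrees of its vertices and is a whole
component (`sameCycle_of_mem_supp`), so a parity count shows that each component contains the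
prescribed number of triples.

For the algorithm, the same correspondence turns minimum 2-factors into an assignment problem: half
the multiplicity matrix of a 2-factor is doubly stochastic and has the weight of the 2-factor as its
assignment cost. An auction with bid increment 1 solves the assignment problem up to an error of n,
by weak duality with the prices as dual variables (`sum_mul_le_of_slack`). The distances here are
integers, so scaling them by n + 1 makes the solution exact, and a large penalty on equally coloured
pairs keeps them out whenever that is possible. Prices stay below a polynomial bound and each bid
raises one of them, so polynomially many bids suffice.

Running times are tracked by a total-correctness logic. All loops are counting loops, so a common
bound on the loop counts gives a bound on the steps that is read off from the syntax
(`Cmd.timeBound`). -/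

namespace FairClustering

/-! ### A program logic with built-in time bounds -/

section ProgramLogic

/-- A bound for the number of steps of a program in which no loop is iterated more than `N` times
at each execution. -/
def Cmd.timeBound (N : ℕ) : Cmd → ℕ
  | .skip => 1
  | .assign _ e => e.cost + 1
  | .store _ i j e => i.cost + j.cost + e.cost + 1
  | .seq A B => A.timeBound N + B.timeBound N
  | .ite b A B => b.cost + 1 + (A.timeBound N + B.timeBound N)
  | .loop b A => N * (b.cost + 1 + A.timeBound N) + (b.cost + 1)

/-- `Cmd.timeBound` as a polynomial in the bound for the number of iterations. -/
noncomputable def Cmd.timePoly : Cmd → Polynomial ℕ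
  | .skip => 1
  | .assign _ e => Polynomial.C (e.cost + 1)
  | .store _ i j e => Polynomial.C (i.cost + j.cost + e.cost + 1)
  | .seq A B => A.timePoly + B.timePoly
  | .ite b A B => Polynomial.C (b.cost + 1) + (A.timePoly + B.timePoly)
  | .loop b A =>
      Polynomial.X * (Polynomial.C (b.cost + 1) + A.timePoly) + Polynomial.C (b.cost + 1)

theorem Cmd.eval_timePoly (N : ℕ) (A : Cmd) : A.timePoly.eval N = A.timeBound N := by
  induction A <;> simp_all only [Cmd.timePoly, Cmd.timeBound, Polynomial.eval_add,
    Polynomial.eval_mul, Polynomial.eval_X, Polynomial.eval_C, Polynomial.eval_one]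

/-- Whether the program contains an assignment to the variable `x`. -/
def Cmd.writesVar (x : ℕ) : Cmd → Bool
  | .skip => false
  | .assign y _ => x == y
  | .store _ _ _ _ => false
  | .seq A B => A.writesVar x || B.writesVar x
  | .ite _ A B => A.writesVar x || B.writesVar x
  | .loop _ A => A.writesVar x

/-- Whether the program contains an assignment to an entry of the array `a`. -/
def Cmd.writesArr (a : ℕ) : Cmd → Bool
  | .skip => false
  | .assign _ _ => false
  | .store b _ _ _ => a == b
  | .seq A B => A.writesArr a || B.writesArr a
  | .ite _ A B => A.writesArr a || B.writesArr a
  | .loop _ A => A.writesArr a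

/-- The states `s` and `s'` agree on the memory to which `A` does not write. -/
def Frame (A : Cmd) (s s' : State) : Prop :=
  (∀ x, A.writesVar x = false → s'.var x = s.var x) ∧
  ∀ a, A.writesArr a = false → s'.arr a = s.arr a

theorem Frame.refl (A : Cmd) (s : State) : Frame A s s := ⟨fun _ _ => rfl, fun _ _ => rfl⟩

theorem Frame.trans {A : Cmd} {s s' s'' : State} (h : Frame A s s') (h' : Frame A s' s'') :
    Frame A s s'' :=
  ⟨fun x hx => (h'.1 x hx).trans (h.1 x hx), fun a ha => (h'.2 a ha).trans (h.2 a ha)⟩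

theorem Frame.mono {A B : Cmd} {s s' : State} (h : Frame A s s')
    (hv : ∀ x, B.writesVar x = false → A.writesVar x = false)
    (ha : ∀ a, B.writesArr a = false → A.writesArr a = false) : Frame B s s' :=
  ⟨fun x hx => h.1 x (hv x hx), fun a hx => h.2 a (ha a hx)⟩

/-- The written variables and arrays are computed from the syntax, so for a concrete program each
later preservation fact holds by `rfl`. -/
theorem Exec.frame {A : Cmd} {s s' : State} {t : ℕ} (h : Exec A s t s') : Frame A s s' := by
  induction h with
  | skip s => exact Frame.refl _ _
  | assign s x e =>
    refine ⟨fun y hy => ?_, fun _ _ => rfl⟩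
    have hxy : y ≠ x := by simpa [Cmd.writesVar] using hy
    simp [State.setVar, hxy]
  | store s a i j e =>
    refine ⟨fun _ _ => rfl, fun b hb => ?_⟩
    have hab : b ≠ a := by simpa [Cmd.writesArr] using hb
    funext i' j'
    simp [State.setArr, hab]
  | seq _ _ h₁ h₂ =>
    refine (h₁.mono ?_ ?_).trans (h₂.mono ?_ ?_) <;> intro x hx <;>
      simp_all [Cmd.writesVar, Cmd.writesArr]
  | iteTrue _ _ h₁ =>
    refine h₁.mono ?_ ?_ <;> intro x hx <;> simp_all [Cmd.writesVar, Cmd.writesArr]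
  | iteFalse _ _ h₁ =>
    refine h₁.mono ?_ ?_ <;> intro x hx <;> simp_all [Cmd.writesVar, Cmd.writesArr]
  | loopTrue _ _ _ h₁ h₂ =>
    refine (h₁.mono ?_ ?_).trans h₂ <;> intro x hx <;> simp_all [Cmd.writesVar, Cmd.writesArr]
  | loopFalse _ => exact Frame.refl _ _

/-- Started in `s`, the program `A` halts, in a state with the property `Q`, after at most
`A.timeBound N` steps. -/
def Runs (N : ℕ) (A : Cmd) (s : State) (Q : State → Prop) : Prop :=
  ∃ t s', Exec A s t s' ∧ t ≤ A.timeBound N ∧ Q s'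

variable {N : ℕ} {A B : Cmd} {s : State} {Q R : State → Prop}

theorem Runs.conseq (h : Runs N A s R) (hQ : ∀ s', Frame A s s' → R s' → Q s') :
    Runs N A s Q := by
  obtain ⟨t, s', he, ht, hr⟩ := h
  exact ⟨t, s', he, ht, hQ s' he.frame hr⟩

theorem Runs.skip (h : Q s) : Runs N .skip s Q := ⟨1, s, .skip s, le_rfl, h⟩

theorem Runs.assign {x : ℕ} {e : Expr} (h : Q (s.setVar x (e.eval s))) :
    Runs N (.assign x e) s Q := ⟨_, _, .assign s x e, le_rfl, h⟩

theorem Runs.store {a : ℕ} {i j e : Expr} (h : Q (s.setArr a (i.eval s) (j.eval s) (e.eval s))) :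
    Runs N (.store a i j e) s Q := ⟨_, _, .store s a i j e, le_rfl, h⟩

theorem Runs.seq (h : Runs N A s fun s' => Runs N B s' Q) : Runs N (.seq A B) s Q := by
  obtain ⟨t, s', he, ht, t', s'', he', ht', hQ⟩ := h
  exact ⟨_, _, .seq he he', Nat.add_le_add ht ht', hQ⟩

theorem Runs.ite {b : Expr} (hA : b.eval s ≠ 0 → Runs N A s Q)
    (hB : b.eval s = 0 → Runs N B s Q) : Runs N (.ite b A B) s Q := by
  by_cases hb : b.eval s = 0
  · obtain ⟨t, s', he, ht, hQ⟩ := hB hb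
    exact ⟨_, _, .iteFalse hb he, by simp only [Cmd.timeBound]; omega, hQ⟩
  · obtain ⟨t, s', he, ht, hQ⟩ := hA hb
    exact ⟨_, _, .iteTrue hb he, by simp only [Cmd.timeBound]; omega, hQ⟩

/-- The loop in which the variable `i` runs from `0` up to the value of the variable `x`. -/
def forLoop (i x : ℕ) (A : Cmd) : Cmd :=
  .seq (.assign i (.const 0))
    (.loop (.lt (.var i) (.var x)) (.seq A (.assign i (.add (.var i) (.const 1)))))

/-- The invariant rule for counting loops. -/
theorem Runs.forLoop {i x : ℕ} (I : ℕ → State → Prop) (hx : s.var x ≤ N)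
    (hi : A.writesVar i = false) (hwx : A.writesVar x = false) (hxi : x ≠ i)
    (h0 : I 0 (s.setVar i 0))
    (hstep : ∀ k s', k < s.var x → s'.var i = k → Frame (forLoop i x A) s s' → I k s' →
      Runs N A s' fun s'' => I (k + 1) (s''.setVar i (k + 1)))
    (hQ : ∀ s', Frame (FairClustering.forLoop i x A) s s' → I (s.var x) s' → Q s') :
    Runs N (forLoop i x A) s Q := by
  -- Induction on the number m of remaining iterations. The first 4 pays for the test and the second
  -- for the increment; the last 4 is the final, failing test.
  have key : ∀ m k s', k + m = s.var x → s'.var i = k → s'.var x = s.var x →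
      Frame (FairClustering.forLoop i x A) s s' → I k s' →
      ∃ t s'', Exec (.loop (.lt (.var i) (.var x)) (.seq A (.assign i (.add (.var i) (.const 1)))))
        s' t s'' ∧ t ≤ m * (4 + (A.timeBound N + 4)) + 4 ∧ Q s'' := by
    intro m
    induction m with
    | zero =>
      intro k s' hk hki hkx hF hI
      refine ⟨_, _, .loopFalse ?_, ?_, hQ s' hF ?_⟩
      · simp [Expr.eval, hki, hkx]; omega
      · simp [Expr.cost]
      · rwa [← hk]
    | succ m ih =>
      intro k s' hk hki hkx hF hI
      obtain ⟨t, s'', he, ht, hI'⟩ := hstep k s' (by omega) hki hF hI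
      have hf := he.frame
      have e2 := Exec.assign s'' i (.add (.var i) (.const 1))
      have hval : (Expr.add (.var i) (.const 1)).eval s'' = k + 1 := by
        simp [Expr.eval, hf.1 i hi, hki]
      rw [hval] at e2
      have hxi' : (s''.setVar i (k + 1)).var x = s.var x := by
        simp [State.setVar, hxi, hf.1 x hwx, hkx]
      have hF' : Frame (FairClustering.forLoop i x A) s (s''.setVar i (k + 1)) := by
        refine (hF.trans (hf.mono ?_ ?_)).trans (e2.frame.mono ?_ ?_) <;> intro y hy <;>
          simp_all [Cmd.writesVar, Cmd.writesArr, FairClustering.forLoop]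
      obtain ⟨t', s3, he', ht', hq⟩ := ih (k + 1) _ (by omega) (by simp [State.setVar]) hxi' hF' hI'
      refine ⟨_, _, .loopTrue ?_ (.seq he e2) he', ?_, hq⟩
      · simp [Expr.eval, hki, hkx]; omega
      · simp only [Expr.cost]
        rw [Nat.add_mul]
        omega
  have e0 := Exec.assign s i (.const 0)
  have hF0 : Frame (FairClustering.forLoop i x A) s (s.setVar i 0) := by
    refine e0.frame.mono ?_ ?_ <;> intro y hy <;>
      simp_all [Cmd.writesVar, Cmd.writesArr, FairClustering.forLoop]
  obtain ⟨t, s', he, ht, hq⟩ := key (s.var x) 0 (s.setVar i 0) (by simp) (by simp [State.setVar])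
    (by simp [State.setVar, hxi]) hF0 h0
  refine ⟨_, _, .seq e0 he, ?_, hq⟩
  have : s.var x * (4 + (A.timeBound N + 4)) ≤ 
      N * (1 + 1 + 1 + 1 + (A.timeBound N + (1 + 1 + 1 + 1))) :=
    Nat.mul_le_mul_right _ hx
  simp only [Cmd.timeBound, Expr.cost, FairClustering.forLoop]
  omega

end ProgramLogic

/-! ### 2-factors and permutations -/

section Permutations

open Finset

theorem IsFair.two_mul_card_le {V κ : Type*} {c : V → κ} {p : Finset V} (hp : IsFair (1 / 2) c p) (k : κ)
    [DecidableEq κ] : 2 * #{v ∈ p | c v = k} ≤ #p := by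
  have := hp k
  rw [show {v : V | v ∈ p ∧ c v = k} = ((({v ∈ p | c v = k} : Finset V)) : Set V) by ext; simp,
    Set.ncard_coe_finset] at this
  have h2 : (2 * #{v ∈ p | c v = k} : ℝ) ≤ #p := by linarith
  exact_mod_cast h2

variable {V κ M : Type*} [Fintype V] [DecidableEq V]

/-- The multiset of edges `{v, σ v}` of a permutation. -/
def permFactor (σ : Equiv.Perm V) (e : Sym2 V) : ℕ := #{v : V | s(v, σ v) = e}

theorem permFactor_self_ne_zero (σ : Equiv.Perm V) (v : V) : permFactor σ s(v, σ v) ≠ 0 := by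
  unfold permFactor
  rw [Finset.card_ne_zero]
  exact ⟨v, by simp⟩

/-- The vertex v lies on the edges to σ v and to its preimage. Counting them as two indicators also
covers the case where these coincide, which gives an edge of multiplicity 2. -/
theorem isTwoFactor_permFactor {c : V → κ} {σ : Equiv.Perm V} (h : ∀ v, c (σ v) ≠ c v) :
    IsTwoFactor c (permFactor σ) := by
  constructor
  · intro e he
    unfold permFactor at he
    rw [Finset.card_ne_zero] at he
    obtain ⟨v, hv⟩ := he
    simp only [mem_filter, mem_univ, true_and] at hv
    subst hv
    exact (h v).symm
  · intro v
    have hne : σ.symm v ≠ v := by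
      intro hv
      apply h v
      conv_rhs => rw [← hv]
      rw [show σ v = v by conv_lhs => rw [← hv]; simp]
      rw [hv]
    have hterm : ∀ u : V, permFactor σ s(v, u) =
        (if u = σ v then 1 else 0) + (if u = σ.symm v then 1 else 0) := by
      intro u
      unfold permFactor
      have hset : ({w : V | s(w, σ w) = s(v, u)} : Finset V) =
          ({w : V | w = v ∧ u = σ v} : Finset V) ∪ ({w : V | w = u ∧ u = σ.symm v} : Finset V) := by
        ext w
        simp only [mem_filter, mem_univ, true_and, mem_union, Sym2.eq_iff]
        constructor
        · rintro (⟨rfl, rfl⟩ | ⟨rfl, rfl⟩)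
          · exact Or.inl ⟨rfl, rfl⟩
          · exact Or.inr ⟨rfl, by simp⟩
        · rintro (⟨rfl, rfl⟩ | ⟨rfl, rfl⟩)
          · exact Or.inl ⟨rfl, rfl⟩
          · exact Or.inr ⟨rfl, by simp⟩
      rw [hset, card_union_of_disjoint]
      · congr 1
        · split_ifs with hu <;> simp [hu, filter_eq']
        · split_ifs with hu <;> simp [hu, filter_eq']
      · rw [Finset.disjoint_left]
        simp only [mem_filter, mem_univ, true_and]
        rintro w ⟨rfl, h1⟩ ⟨h2, h3⟩
        exact hne (by rw [← h3, ← h2])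
    simp_rw [hterm, sum_add_distrib]
    simp

theorem twoFactorCost_permFactor [PseudoMetricSpace M] (φ : V → M) (σ : Equiv.Perm V) :
    twoFactorCost φ (permFactor σ) = ∑ v, dist (φ v) (φ (σ v)) := by
  unfold twoFactorCost permFactor
  have : ∀ v : V, dist (φ v) (φ (σ v)) = edgeWeight φ s(v, σ v) := fun v => rfl
  simp_rw [this]
  rw [← Finset.sum_fiberwise (s := univ) (g := fun v : V => s(v, σ v))]
  refine sum_congr rfl fun e _ => ?_
  rw [Finset.sum_congr rfl (g := fun _ => edgeWeight φ e), sum_const, nsmul_eq_mul]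
  intro v hv
  rw [(mem_filter.1 hv).2]

/-- Twice the weight of a 2-factor is the sum over ordered pairs. -/
theorem two_mul_twoFactorCost [PseudoMetricSpace M] {c : V → κ} (φ : V → M) {x : Sym2 V → ℕ}
    (hx : IsTwoFactor c x) :
    2 * twoFactorCost φ x = ∑ u, ∑ v, (x s(u, v) : ℝ) * dist (φ u) (φ v) := by
  have h1 : ∑ u, ∑ v, (x s(u, v) : ℝ) * dist (φ u) (φ v) =
      ∑ q : V × V, (x s(q.1, q.2) : ℝ) * edgeWeight φ s(q.1, q.2) := by
    rw [Fintype.sum_prod_type]; rfl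
  rw [h1, ← Finset.sum_fiberwise (s := univ) (g := fun q : V × V => s(q.1, q.2)),
    twoFactorCost, mul_sum]
  refine sum_congr rfl fun e _ => ?_
  rw [Finset.sum_congr rfl (g := fun _ => (x e : ℝ) * edgeWeight φ e), sum_const, nsmul_eq_mul]
  · by_cases he : x e = 0
    · simp [he]
    · have hadj := hx.1 e he
      induction e with
      | _ u v =>
      have huv : u ≠ v := ((SimpleGraph.mem_edgeSet _).1 hadj).ne
      have : ({q : V × V | s(q.1, q.2) = s(u, v)} : Finset (V × V)) = {(u, v), (v, u)} := by
        ext ⟨a, b⟩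
        simp
      -- An edge of H is not a loop, so it comes from exactly two ordered pairs.
      rw [this, card_pair (by simp [huv])]
      norm_num
  · intro q hq
    rw [(mem_filter.1 hq).2]

/-- Multiplicities in a 2-factor are at most 2, so there are only finitely many 2-factors. -/
theorem exists_isOptimalTwoFactor [PseudoMetricSpace M] {c : V → κ} (φ : V → M)
    (h : ∃ x : Sym2 V → ℕ, IsTwoFactor c x) : ∃ x : Sym2 V → ℕ, IsOptimalTwoFactor c φ x := by
  have hfin : {x : Sym2 V → ℕ | IsTwoFactor c x}.Finite := by
    refine (Set.finite_Icc (0 : Sym2 V → ℕ) (fun _ => 2)).subset fun x hx => ⟨fun _ => Nat.zero_le _, ?_⟩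
    intro e
    induction e with
    | _ u v =>
    have := hx.2 u
    rw [← this]
    exact single_le_sum (f := fun w => x s(u, w)) (fun _ _ => Nat.zero_le _) (mem_univ v)
  obtain ⟨x, hx, hmin⟩ := Set.exists_min_image _ (twoFactorCost φ) hfin h
  exact ⟨x, hx, hmin⟩

/-- A permutation along the edges of a 2-factor. -/
theorem IsTwoFactor.exists_perm {c : V → κ} {x : Sym2 V → ℕ} (hx : IsTwoFactor c x) :
    ∃ σ : Equiv.Perm V, ∀ v, x s(v, σ v) ≠ 0 := by
  -- Hall's condition by double counting: S sends total multiplicity 2|S| into its neighbourhood T,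
  -- which can absorb at most 2|T|.
  obtain ⟨f, hf, hft⟩ := (Finset.all_card_le_biUnion_card_iff_exists_injective
    (fun v : V => ({u : V | x s(v, u) ≠ 0} : Finset V))).1 (by
      intro S
      set T := S.biUnion (fun v : V => ({u : V | x s(v, u) ≠ 0} : Finset V)) with hT
      have h1 : ∑ v ∈ S, ∑ u ∈ T, x s(v, u) = 2 * #S := by
        rw [sum_congr rfl (g := fun _ => 2), sum_const, smul_eq_mul, mul_comm]
        intro v hv
        rw [← hx.2 v]
        refine sum_subset (subset_univ _) fun u _ hu => ?_
        by_contra hne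
        exact hu (mem_biUnion.2 ⟨v, hv, by simpa using hne⟩)
      have h2 : ∑ v ∈ S, ∑ u ∈ T, x s(v, u) ≤ 2 * #T := by
        rw [sum_comm]
        calc ∑ u ∈ T, ∑ v ∈ S, x s(v, u) ≤ ∑ u ∈ T, 2 := by
              refine sum_le_sum fun u _ => ?_
              rw [← hx.2 u]
              simp_rw [Sym2.eq_swap (b := u)]
              exact sum_le_sum_of_subset (subset_univ _)
          _ = 2 * #T := by simp [mul_comm]
      omega)
  refine ⟨Equiv.ofBijective f (Finite.injective_iff_bijective.1 hf), fun v => ?_⟩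
  simpa using hft v

/-- Inside the parts of a fairlet decomposition there is a permutation that changes all colours. -/
theorem IsFairletDecomposition.exists_perm {c : V → κ} {Q : Finpartition (univ : Finset V)}
    (hQ : IsFairletDecomposition (1 / 2) c Q) :
    ∃ σ : Equiv.Perm V, (∀ v, c (σ v) ≠ c v) ∧ ∀ p ∈ Q.parts, ∀ v ∈ p, σ v ∈ p := by
  classical
  obtain ⟨f, hf, hft⟩ := (Finset.all_card_le_biUnion_card_iff_exists_injective
    (fun v : V => {u ∈ Q.part v | c u ≠ c v})).1 (by
      intro S
      set T := S.biUnion (fun v : V => {u ∈ Q.part v | c u ≠ c v}) with hT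
      -- Neighbours are taken within parts, so Hall's condition can be checked in each part
      -- separately.
      have hsum : ∀ U : Finset V, #U = ∑ p ∈ Q.parts, #(U ∩ p) := by
        intro U
        rw [← card_biUnion, ← inter_biUnion]
        · congr 1
          have := Q.biUnion_parts
          rw [show Q.parts.biUnion (fun p => p) = Q.parts.biUnion id from rfl, this, inter_univ]
        · intro p hp q hq hpq
          exact (Q.disjoint hp hq hpq).mono inter_subset_right inter_subset_right
      rw [hsum S, hsum T]
      refine sum_le_sum fun p hp => ?_
      -- If S ∩ p has a single colour k, its neighbours are the vertices of p not coloured k, at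
      -- least half of p by fairness. If it has two colours, every vertex of p is a neighbour of one
      -- of its vertices.
      by_cases hmono : ∃ k, ∀ v ∈ S ∩ p, c v = k
      · obtain ⟨k, hk⟩ := hmono
        rcases (S ∩ p).eq_empty_or_nonempty with he | ⟨v, hv⟩
        · simp [he]
        have h1 : #(S ∩ p) ≤ #{v ∈ p | c v = k} := card_le_card fun u hu =>
          mem_filter.2 ⟨(mem_inter.1 hu).2, hk u hu⟩
        have h2 : #{v ∈ p | ¬ c v = k} ≤ #(T ∩ p) := by
          refine card_le_card fun u hu => ?_
          rw [mem_filter] at hu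
          refine mem_inter.2 ⟨mem_biUnion.2 ⟨v, (mem_inter.1 hv).1, mem_filter.2 ⟨?_, ?_⟩⟩, hu.1⟩
          · rw [Q.part_eq_of_mem hp (mem_inter.1 hv).2]; exact hu.1
          · rw [hk v hv]; exact hu.2
        have h3 := (hQ p hp).two_mul_card_le k
        have h4 := card_filter_add_card_filter_not (s := p) (fun v => c v = k)
        omega
      · push Not at hmono
        have hne : (S ∩ p).Nonempty := by
          by_contra hem
          rw [not_nonempty_iff_eq_empty] at hem
          rcases (Q.nonempty_of_mem_parts hp) with ⟨w, hw⟩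
          obtain ⟨v, hv, _⟩ := hmono (c w)
          simp [hem] at hv
        obtain ⟨v, hv⟩ := hne
        obtain ⟨w, hw, hwv⟩ := hmono (c v)
        refine card_le_card fun u hu => ?_
        have hup := (mem_inter.1 hu).2
        refine mem_inter.2 ⟨?_, hup⟩
        by_cases huv : c u = c v
        · exact mem_biUnion.2 ⟨w, (mem_inter.1 hw).1, mem_filter.2
            ⟨by rw [Q.part_eq_of_mem hp (mem_inter.1 hw).2]; exact hup, by rw [huv]; exact hwv.symm⟩⟩
        · exact mem_biUnion.2 ⟨v, (mem_inter.1 hv).1, mem_filter.2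
            ⟨by rw [Q.part_eq_of_mem hp (mem_inter.1 hv).2]; exact hup, huv⟩⟩)
  refine ⟨Equiv.ofBijective f (Finite.injective_iff_bijective.1 hf), fun v => ?_, fun p hp v hv => ?_⟩
  · exact (mem_filter.1 (hft v)).2
  · have := (mem_filter.1 (hft v)).1
    rwa [Q.part_eq_of_mem hp hv] at this

end Permutations

/-! ### The cost of a rounding -/

section Cost

open Finset

variable {V κ M : Type*} [PseudoMetricSpace M]

theorem isFair_of_injOn {V κ : Type*} {c : V → κ} {p : Finset V} (h2 : 2 ≤ #p) (hc : Set.InjOn c p) :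
    IsFair (1 / 2) c p := by
  intro k
  have h1 : {v : V | v ∈ p ∧ c v = k}.ncard ≤ 1 := by
    rw [Set.ncard_le_one]
    rintro a ⟨ha, rfl⟩ b ⟨hb, hab⟩
    exact hc ha hb hab.symm
  have h1' : (({v : V | v ∈ p ∧ c v = k}.ncard : ℕ) : ℝ) ≤ 1 := by exact_mod_cast h1
  have h2' : (2 : ℝ) ≤ #p := by exact_mod_cast h2
  linarith

theorem mcostPart_le (φ : V → M) (p : Finset V) (m : M) :
    mcostPart φ p ≤ ∑ v ∈ p, dist m (φ v) :=
  ciInf_le ⟨0, by rintro _ ⟨m, rfl⟩; exact sum_nonneg fun _ _ => dist_nonneg⟩ m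

theorem edgeWeight_nonneg [Fintype V] [DecidableEq V] (φ : V → M) (e : Sym2 V) :
    0 ≤ edgeWeight φ e := by
  induction e with
  | _ u v => exact dist_nonneg

variable [Fintype V] [DecidableEq V]

theorem IsRounding.isFairletDecomposition {c : V → κ} {x : Sym2 V → ℕ}
    {P : Finpartition (univ : Finset V)} (hx : IsTwoFactor c x) (hP : IsRounding c x P) :
    IsFairletDecomposition (1 / 2) c P ∧ ∀ p ∈ P.parts, 2 ≤ #p ∧ #p ≤ 3 := by
  have key : ∀ p ∈ P.parts, Set.InjOn c p ∧ 2 ≤ #p ∧ #p ≤ 3 := by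
    intro p hp
    rcases hP.1 p hp with ⟨u, v, huv, rfl⟩ | ⟨u, v, w, -, -, h1, h2, h3, rfl⟩
    · have hc : c u ≠ c v := hx.1 _ huv
      refine ⟨?_, ?_⟩
      · intro a ha b hb hab
        simp only [coe_insert, coe_singleton, Set.mem_insert_iff, Set.mem_singleton_iff] at ha hb
        rcases ha with rfl | rfl <;> rcases hb with rfl | rfl <;> simp_all
      · rw [card_pair (fun h => hc (congrArg c h))]; omega
    · refine ⟨?_, ?_⟩
      · intro a ha b hb hab
        simp only [coe_insert, coe_singleton, Set.mem_insert_iff, Set.mem_singleton_iff] at ha hb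
        rcases ha with rfl | rfl | rfl <;> rcases hb with rfl | rfl | rfl <;> simp_all
      · rw [card_eq_three.2 ⟨u, v, w, fun h => h1 (congrArg c h), fun h => h3 (congrArg c h),
          fun h => h2 (congrArg c h), rfl⟩]
        omega
  exact ⟨fun p hp => isFair_of_injOn (key p hp).2.1 (key p hp).1, fun p hp => (key p hp).2⟩

/-- The cost of a rounding is at most the weight of the edges of the 2-factor inside its parts. -/
theorem IsRounding.mcost_le {c : V → κ} (φ : V → M) {x : Sym2 V → ℕ}
    {P : Finpartition (univ : Finset V)} (hx : IsTwoFactor c x) (hP : IsRounding c x P) :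
    mcost φ P ≤ twoFactorCost φ x := by
  have hnn : ∀ e : Sym2 V, 0 ≤ (x e : ℝ) * edgeWeight φ e := fun e =>
    mul_nonneg (Nat.cast_nonneg _) (edgeWeight_nonneg φ e)
  have hle : ∀ u v : V, x s(u, v) ≠ 0 → dist (φ u) (φ v) ≤ (x s(u, v) : ℝ) * edgeWeight φ s(u, v) := by
    intro u v h
    have : (1 : ℝ) ≤ x s(u, v) := by exact_mod_cast Nat.one_le_iff_ne_zero.2 h
    exact le_mul_of_one_le_left dist_nonneg this
  -- The edges of the 2-factor inside p. They are disjoint for disjoint parts, so no edge is charged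
  -- twice.
  let E : Finset V → Finset (Sym2 V) := fun p => {e | x e ≠ 0 ∧ ∀ v ∈ e, v ∈ p}
  have h1 : ∀ p ∈ P.parts, mcostPart φ p ≤ ∑ e ∈ E p, (x e : ℝ) * edgeWeight φ e := by
    intro p hp
    rcases hP.1 p hp with ⟨u, v, huv, rfl⟩ | ⟨u, v, w, huv, hvw, h1, h2, h3, rfl⟩
    · refine (mcostPart_le φ _ (φ u)).trans ?_
      have hne : u ≠ v := ((SimpleGraph.mem_edgeSet _).1 (hx.1 _ huv)).ne
      rw [sum_pair hne, dist_self, zero_add]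
      refine (hle u v huv).trans (single_le_sum (f := fun e => (x e : ℝ) * edgeWeight φ e)
        (fun e _ => hnn e) ?_)
      simp [E, huv]
    · refine (mcostPart_le φ _ (φ v)).trans ?_
      have huv' : u ≠ v := fun h => h1 (congrArg c h)
      have hvw' : v ≠ w := fun h => h2 (congrArg c h)
      have huw' : u ≠ w := fun h => h3 (congrArg c h)
      rw [sum_insert (by simp [huv', huw']), sum_pair hvw', dist_self, zero_add, dist_comm]
      have hsub : ({s(u, v), s(v, w)} : Finset (Sym2 V)) ⊆ E {u, v, w} := by
        intro e he
        simp only [mem_insert, mem_singleton] at he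
        rcases he with rfl | rfl <;> simp [E, huv, hvw]
      refine le_trans ?_ (sum_le_sum_of_subset_of_nonneg hsub fun e _ _ => hnn e)
      rw [sum_pair (by simp [huv', huw'])]
      exact add_le_add (hle u v huv) (hle v w hvw)
  calc mcost φ P ≤ ∑ p ∈ P.parts, ∑ e ∈ E p, (x e : ℝ) * edgeWeight φ e := sum_le_sum h1
    _ = ∑ e ∈ P.parts.biUnion E, (x e : ℝ) * edgeWeight φ e := by
        rw [sum_biUnion]
        intro p hp q hq hpq
        rw [Function.onFun, Finset.disjoint_left]
        intro e he he'
        induction e with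
        | _ u v =>
        have a1 := (mem_filter.1 he).2.2 u (by simp)
        have a2 := (mem_filter.1 he').2.2 u (by simp)
        exact Finset.disjoint_left.1 (P.disjoint hp hq hpq) a1 a2
    _ ≤ twoFactorCost φ x := sum_le_sum_of_subset_of_nonneg (subset_univ _) fun e _ _ => hnn e

/-- The route from v to σ v through a centre of the part costs the two distances to the centre.
Since σ permutes the part, each vertex is counted twice in total. -/
theorem twoFactorCost_permFactor_le (φ : V → M) {Q : Finpartition (univ : Finset V)}
    {σ : Equiv.Perm V} (hσ : ∀ p ∈ Q.parts, ∀ v ∈ p, σ v ∈ p) :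
    twoFactorCost φ (permFactor σ) ≤ 2 * mcost φ Q := by
  rw [twoFactorCost_permFactor, ← Q.biUnion_parts, sum_biUnion (fun p hp q hq h => Q.disjoint hp hq h),
    mcost, mul_sum]
  refine sum_le_sum fun p hp => ?_
  obtain ⟨w, hw⟩ := Q.nonempty_of_mem_parts hp
  have : Nonempty M := ⟨φ w⟩
  have hbij : ∀ m : M, ∑ v ∈ p, dist m (φ (σ v)) = ∑ v ∈ p, dist m (φ v) := by
    intro m
    have himg : p.image σ = p := by
      refine eq_of_subset_of_card_le (fun v hv => ?_) ?_
      · obtain ⟨u, hu, rfl⟩ := mem_image.1 hv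
        exact hσ p hp u hu
      · rw [card_image_of_injective _ σ.injective]
    conv_rhs => rw [← himg]
    rw [sum_image (fun a _ b _ h => σ.injective h)]
  have : (∑ v ∈ p, dist (φ v) (φ (σ v))) / 2 ≤ mcostPart φ p := by
    refine le_ciInf fun m => ?_
    have h1 : ∑ v ∈ p, dist (φ v) (φ (σ v)) ≤ ∑ v ∈ p, (dist m (φ v) + dist m (φ (σ v))) :=
      sum_le_sum fun v _ => by
        have := dist_triangle (φ v) m (φ (σ v))
        rwa [dist_comm (φ v) m] at this
    rw [sum_add_distrib, hbij] at h1
    linarith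
  simp only [id]
  linarith

/-- The weight of the optimal 2-factor lies between the cost of P and twice the cost of Q: it is at
most that of the 2-factor built from a permutation inside the parts of Q. -/
theorem IsRounding.isGoodDecomposition {c : V → κ} (φ : V → M) {x : Sym2 V → ℕ}
    {P : Finpartition (univ : Finset V)} (hx : IsOptimalTwoFactor c φ x) (hP : IsRounding c x P) :
    IsGoodDecomposition c φ P := by
  refine ⟨(hP.isFairletDecomposition hx.1).1, (hP.isFairletDecomposition hx.1).2, fun Q hQ => ?_⟩
  obtain ⟨σ, hσ, hσQ⟩ := hQ.exists_perm
  exact (hP.mcost_le φ hx.1).trans ((hx.2 _ (isTwoFactor_permFactor hσ)).trans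
    (twoFactorCost_permFactor_le φ hσQ))

end Cost

/-! ### Cutting the cycles of a permutation -/

section Rounding

open Finset Function

variable {V κ : Type*}

/-- The index of the vertex that names the part of the `k`-th vertex of a cycle of length `L`:
the vertices `2 * j` and `2 * j + 1` form a part, and in a cycle of odd length the last vertex
belongs to the part of the vertex `0`. -/
def cutIndex (L k : ℕ) : ℕ := if k % 2 = 0 ∧ k + 1 = L then 0 else 2 * (k / 2)

/-- The labelling `lab` cuts the cycle of `r` into the parts given by `cutIndex`. -/
structure IsCutAt (c : V → κ) (σ : Equiv.Perm V) (lab : V → V) (r : V) : Prop where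
  color : Odd (minimalPeriod σ r) → c (σ.symm r) ≠ c (σ r)
  label : ∀ k < minimalPeriod σ r, lab (σ^[k] r) = σ^[cutIndex (minimalPeriod σ r) k] r

/-- The labelling `lab` cuts every cycle of `σ`. -/
def IsCut (c : V → κ) (σ : Equiv.Perm V) (lab : V → V) : Prop :=
  ∀ v, ∃ r k, σ^[k] r = v ∧ IsCutAt c σ lab r

theorem cutIndex_lt {L k : ℕ} (h : k < L) : cutIndex L k < L := by
  unfold cutIndex
  split_ifs <;> omega

theorem mem_periodicPts_perm [Finite V] (σ : Equiv.Perm V) (v : V) : v ∈ periodicPts σ :=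
  σ.injective.mem_periodicPts v

theorem minimalPeriod_perm_pos [Finite V] (σ : Equiv.Perm V) (v : V) : 0 < minimalPeriod σ v :=
  minimalPeriod_pos_of_mem_periodicPts (mem_periodicPts_perm σ v)

theorem sameCycle_iterate (σ : Equiv.Perm V) (k : ℕ) (v : V) : σ.SameCycle v (σ^[k] v) :=
  ⟨k, by rw [zpow_natCast, Equiv.Perm.iterate_eq_pow]⟩

theorem exists_iterate_lt_of_sameCycle [Finite V] {σ : Equiv.Perm V} {u v : V}
    (h : σ.SameCycle u v) : ∃ k < minimalPeriod σ u, σ^[k] u = v := by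
  obtain ⟨k, hk⟩ := h.exists_nat_pow_eq
  refine ⟨k % minimalPeriod σ u, Nat.mod_lt _ (minimalPeriod_perm_pos σ u), ?_⟩
  rw [iterate_mod_minimalPeriod_eq, Equiv.Perm.iterate_eq_pow, hk]

theorem iterate_inj_of_lt {σ : Equiv.Perm V} {r : V} {j k : ℕ} (hj : j < minimalPeriod σ r)
    (hk : k < minimalPeriod σ r) : σ^[j] r = σ^[k] r ↔ j = k :=
  iterate_eq_iterate_iff_of_lt_minimalPeriod hj hk

theorem symm_apply_eq_iterate [Finite V] (σ : Equiv.Perm V) (r : V) :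
    σ.symm r = σ^[minimalPeriod σ r - 1] r := by
  rw [Equiv.symm_apply_eq, ← iterate_succ_apply' (f := σ), Nat.succ_eq_add_one,
    Nat.sub_add_cancel (minimalPeriod_perm_pos σ r), iterate_minimalPeriod]

/-- In a properly coloured odd cycle there are three consecutive vertices of distinct colours. -/
theorem exists_iterate_color_ne {c : V → κ} {σ : Equiv.Perm V} (hσ : ∀ v, c (σ v) ≠ c v) {s : V}
    (hs : Odd (minimalPeriod σ s)) : ∃ k < minimalPeriod σ s, c (σ^[k] s) ≠ c (σ (σ (σ^[k] s))) := by
  by_contra! hcon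
  have hall : ∀ k, c (σ^[k] s) = c (σ (σ (σ^[k] s))) := by
    intro k
    rw [← iterate_mod_minimalPeriod_eq]
    exact hcon _ (Nat.mod_lt _ hs.pos)
  -- With period two, all even positions have the colour of s. For odd length, the position one
  -- after a full turn is even, yet its vertex is σ s.
  have heven : ∀ m, c (σ^[2 * m] s) = c s := by
    intro m
    induction m with
    | zero => rfl
    | succ m ih =>
      rw [← ih, hall (2 * m), ← iterate_succ_apply' (f := σ), ← iterate_succ_apply' (f := σ)]
      rfl
  obtain ⟨m, hm⟩ := hs
  apply hσ s
  rw [← heven (m + 1), show 2 * (m + 1) = minimalPeriod σ s + 1 by omega, iterate_succ_apply',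
    iterate_minimalPeriod]

/-- The root becomes the middle of the triple of an odd cycle, hence the shift by one from the
vertex found by `exists_iterate_color_ne`. An even cycle may be cut anywhere. -/
theorem exists_cut_root [Finite V] {c : V → κ} {σ : Equiv.Perm V} (hσ : ∀ v, c (σ v) ≠ c v) (s : V) :
    ∃ r, σ.SameCycle s r ∧ (Odd (minimalPeriod σ r) → c (σ.symm r) ≠ c (σ r)) := by
  by_cases hs : Odd (minimalPeriod σ s)
  · obtain ⟨k, -, hk⟩ := exists_iterate_color_ne hσ hs
    refine ⟨σ (σ^[k] s), ?_, fun _ => by simpa using hk⟩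
    rw [← iterate_succ_apply' (f := σ)]
    exact sameCycle_iterate σ _ s
  · exact ⟨s, Equiv.Perm.SameCycle.refl σ s, fun h => absurd h hs⟩

theorem exists_isCut [Finite V] {c : V → κ} {σ : Equiv.Perm V} (hσ : ∀ v, c (σ v) ≠ c v) :
    ∃ lab, IsCut c σ lab := by
  classical
  choose g hg hgc using exists_cut_root hσ
  -- Choosing a representative of the cycle first makes the root depend on the cycle only, so that
  -- labels of different vertices of a cycle are consistent.
  let root : V → V := fun v => g (Quotient.out (s := Equiv.Perm.SameCycle.setoid σ) ⟦v⟧)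
  have hrv : ∀ v, σ.SameCycle (root v) v := fun v =>
    ((hg _).symm.trans (Quotient.mk_out (s := Equiv.Perm.SameCycle.setoid σ) v))
  have hrr : ∀ u v, σ.SameCycle u v → root u = root v := by
    intro u v h
    simp only [root]
    rw [show (Quotient.mk (Equiv.Perm.SameCycle.setoid σ) u) = Quotient.mk _ v from Quotient.sound h]
  choose idx hidx hidx' using fun v => exists_iterate_lt_of_sameCycle (hrv v)
  refine ⟨fun v => σ^[cutIndex (minimalPeriod σ (root v)) (idx v)] (root v), fun v =>
    ⟨root v, idx v, hidx' v, hgc _, fun k hk => ?_⟩⟩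
  have h1 : root (σ^[k] (root v)) = root v :=
    hrr _ _ ((sameCycle_iterate σ k (root v)).symm.trans (hrv v))
  have h2 : idx (σ^[k] (root v)) = k := by
    have a := hidx (σ^[k] (root v))
    have b := hidx' (σ^[k] (root v))
    rw [h1] at a b
    exact (iterate_inj_of_lt a hk).1 b
  simp only [h1, h2]

/-- An odd cycle that is not a fixed point has length at least 3. -/
theorem symm_ne_of_odd {σ : Equiv.Perm V} {r : V} (h1 : σ r ≠ r) (hodd : Odd (minimalPeriod σ r)) : σ.symm r ≠ σ r := by
  intro he
  have h2 : σ^[2] r = r := by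
    change σ (σ r) = r
    rw [← he, Equiv.apply_symm_apply]
  have hd : minimalPeriod σ r ∣ 2 := IsPeriodicPt.minimalPeriod_dvd h2
  rcases (Nat.dvd_prime Nat.prime_two).1 hd with h | h
  · exact h1 (minimalPeriod_eq_one_iff_isFixedPt.1 h)
  · rw [h] at hodd
    exact absurd hodd (by decide)

theorem IsCut.sameCycle_lab [Finite V] {c : V → κ} {σ : Equiv.Perm V} {lab : V → V}
    (h : IsCut c σ lab) (v : V) : σ.SameCycle v (lab v) := by
  obtain ⟨r, k, hk, hr⟩ := h v
  have h1 : σ.SameCycle r v := hk ▸ sameCycle_iterate σ k r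
  obtain ⟨k', hk', rfl⟩ := exists_iterate_lt_of_sameCycle h1
  rw [hr.label k' hk']
  exact h1.symm.trans (sameCycle_iterate σ _ r)

/-! ### The partition into fibres of a cutting labelling -/

variable [Fintype V] [DecidableEq V] {c : V → κ} {σ : Equiv.Perm V} {lab : V → V}
  {P : Finpartition (univ : Finset V)}

/-- The partition `P` consists of the fibres of `lab`. -/
def IsFibers (lab : V → V) (P : Finpartition (univ : Finset V)) : Prop :=
  ∀ u v : V, (∃ p ∈ P.parts, u ∈ p ∧ v ∈ p) ↔ lab u = lab v

theorem exists_isFibers (lab : V → V) : ∃ P : Finpartition (univ : Finset V), IsFibers lab P := by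
  refine ⟨Finpartition.ofSetoid (Setoid.ker lab), fun u v => ?_⟩
  rw [← Finpartition.mem_part_iff_exists, Finpartition.mem_part_ofSetoid_iff_rel]
  exact eq_comm

theorem IsFibers.mem_iff (hP : IsFibers lab P) {p : Finset V} (hp : p ∈ P.parts) {v : V} (hv : v ∈ p)
    (u : V) : u ∈ p ↔ lab u = lab v := by
  rw [← hP]
  refine ⟨fun hu => ⟨p, hp, hu, hv⟩, ?_⟩
  rintro ⟨q, hq, hu, hv'⟩
  rwa [P.eq_of_mem_parts hp hq hv hv']

theorem IsFibers.sameCycle (h : IsCut c σ lab) (hP : IsFibers lab P) {p : Finset V} (hp : p ∈ P.parts)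
    {u v : V} (hu : u ∈ p) (hv : v ∈ p) : σ.SameCycle u v := by
  have := (hP.mem_iff hp hv u).1 hu
  exact (h.sameCycle_lab u).trans (this ▸ (h.sameCycle_lab v).symm)

/-- The two kinds of parts. -/
theorem IsFibers.part_cases (h : IsCut c σ lab) (hP : IsFibers lab P) {p : Finset V}
    (hp : p ∈ P.parts) {r v : V} (hr : IsCutAt c σ lab r) (hv : v ∈ p) (hrv : σ.SameCycle r v)
    (h1 : σ r ≠ r) :
    (Odd (minimalPeriod σ r) ∧ p = {σ.symm r, r, σ r}) ∨ ∃ u, p = {u, σ u} := by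
  obtain ⟨k, hk, rfl⟩ := exists_iterate_lt_of_sameCycle hrv
  set L := minimalPeriod σ r with hL
  have hL1 : L ≠ 1 := fun h => h1 (minimalPeriod_eq_one_iff_isFixedPt.1 h)
  have hmem : ∀ u, u ∈ p ↔ ∃ k' < L, σ^[k'] r = u ∧ cutIndex L k' = cutIndex L k := by
    intro u
    rw [hP.mem_iff hp hv u]
    constructor
    · intro hu
      have : σ.SameCycle r u := hrv.trans ((h.sameCycle_lab _).trans (hu ▸ (h.sameCycle_lab u).symm))
      obtain ⟨k', hk', rfl⟩ := exists_iterate_lt_of_sameCycle this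
      refine ⟨k', hk', rfl, ?_⟩
      rw [hr.label k hk, hr.label k' hk'] at hu
      exact (iterate_inj_of_lt (cutIndex_lt hk') (cutIndex_lt hk)).1 hu
    · rintro ⟨k', hk', rfl, he⟩
      rw [hr.label k hk, hr.label k' hk', he]
  have hsymm := symm_apply_eq_iterate σ r
  rw [← hL] at hsymm
  -- Only the root's part in an odd cycle is a triple, with indices L - 1, 0 and 1. Every other part
  -- consists of the indices 2j and 2j + 1.
  by_cases hc : Odd L ∧ cutIndex L k = 0
  · left
    refine ⟨hc.1, ?_⟩
    have hodd := hc.1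
    rw [Nat.odd_iff] at hodd
    ext u
    rw [hmem, hsymm, hc.2]
    simp only [mem_insert, mem_singleton]
    constructor
    · rintro ⟨k', hk', rfl, he⟩
      unfold cutIndex at he
      have : k' = L - 1 ∨ k' = 0 ∨ k' = 1 := by split_ifs at he <;> omega
      rcases this with rfl | rfl | rfl
      · exact Or.inl rfl
      · exact Or.inr (Or.inl rfl)
      · exact Or.inr (Or.inr rfl)
    · unfold cutIndex
      rintro (rfl | rfl | rfl)
      · exact ⟨L - 1, by omega, rfl, if_pos (by omega)⟩
      · exact ⟨0, by omega, rfl, by simp⟩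
      · exact ⟨1, by omega, rfl, by simp⟩
  · right
    have hno : ¬ (k % 2 = 0 ∧ k + 1 = L) := by
      intro hkk
      exact hc ⟨Nat.odd_iff.2 (by omega), if_pos hkk⟩
    have hlt : 2 * (k / 2) + 1 < L := by
      by_cases hk2 : k % 2 = 0 <;> omega
    refine ⟨σ^[2 * (k / 2)] r, ?_⟩
    ext u
    rw [hmem, ← iterate_succ_apply' (f := σ)]
    simp only [mem_insert, mem_singleton]
    have hck : cutIndex L k = 2 * (k / 2) := if_neg hno
    rw [hck] at hc ⊢
    rw [Nat.odd_iff] at hc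
    constructor
    · rintro ⟨k', hk', rfl, he⟩
      unfold cutIndex at he
      have : k' = 2 * (k / 2) ∨ k' = 2 * (k / 2) + 1 := by split_ifs at he <;> omega
      rcases this with rfl | rfl
      · exact Or.inl rfl
      · exact Or.inr rfl
    · unfold cutIndex
      rintro (rfl | rfl)
      · exact ⟨_, by omega, rfl, by rw [if_neg (by omega)]; omega⟩
      · exact ⟨_, hlt, rfl, by rw [if_neg (by omega)]; omega⟩

theorem card_symm_triple {r : V} (h1 : σ r ≠ r) (hodd : Odd (minimalPeriod σ r)) :
    #({σ.symm r, r, σ r} : Finset V) = 3 :=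
  card_eq_three.2 ⟨_, _, _, fun h => h1 ((Equiv.symm_apply_eq σ).1 h).symm, symm_ne_of_odd h1 hodd,
    h1.symm, rfl⟩

/-! ### Cycles of the permutation and components of the 2-factor -/

variable {x : Sym2 V → ℕ}

theorem adj_supportGraph_perm (hx : IsTwoFactor c x) (hσ : ∀ v, x s(v, σ v) ≠ 0) (v : V) :
    (supportGraph x).Adj v (σ v) :=
  (SimpleGraph.fromEdgeSet_adj _).2 ⟨hσ v, ((SimpleGraph.mem_edgeSet _).1 (hx.1 _ (hσ v))).ne⟩

theorem mem_supp_of_sameCycle (hx : IsTwoFactor c x) (hσ : ∀ v, x s(v, σ v) ≠ 0)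
    {K : (supportGraph x).ConnectedComponent} {u v : V} (huv : σ.SameCycle u v) (hu : u ∈ K.supp) :
    v ∈ K.supp := by
  obtain ⟨k, -, rfl⟩ := exists_iterate_lt_of_sameCycle huv
  clear huv
  induction k with
  | zero => exact hu
  | succ k ih =>
    rw [iterate_succ_apply']
    exact K.mem_supp_of_adj_mem_supp ih (adj_supportGraph_perm hx hσ _)

/-- A cycle of odd length of `σ` is a whole component of the 2-factor. -/
theorem sameCycle_of_mem_supp (hx : IsTwoFactor c x) (hσ : ∀ v, x s(v, σ v) ≠ 0)
    {K : (supportGraph x).ConnectedComponent} {u v : V} (hodd : Odd (minimalPeriod σ u))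
    (hu : u ∈ K.supp) (hv : v ∈ K.supp) : σ.SameCycle u v := by
  have hreach : (supportGraph x).Reachable u v := by
    rw [SimpleGraph.ConnectedComponent.mem_supp_iff] at hu hv
    exact SimpleGraph.ConnectedComponent.exact (hu.trans hv.symm)
  obtain ⟨w⟩ := hreach
  clear hv hu
  induction w with
  | nil => exact Equiv.Perm.SameCycle.refl _ _
  | @cons a b d hab _ ih =>
    have hxab : x s(a, b) ≠ 0 := ((SimpleGraph.fromEdgeSet_adj _).1 hab).1
    have h1 : σ a ≠ a := (adj_supportGraph_perm hx hσ a).ne'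
    have hne := symm_ne_of_odd h1 hodd
    have hsymm : x s(a, σ.symm a) ≠ 0 := by
      have := hσ (σ.symm a)
      rwa [Equiv.apply_symm_apply, Sym2.eq_swap] at this
    have hb : b = σ a ∨ b = σ.symm a := by
      -- The two neighbours of a on its odd cycle are distinct and already exhaust the degree 2, so
      -- there is no room for a third neighbour b.
      by_contra! hb
      have hsum : ∑ w ∈ ({b, σ a, σ.symm a} : Finset V), x s(a, w) ≤ 2 := by
        rw [← hx.2 a]
        exact sum_le_sum_of_subset (subset_univ _)
      rw [sum_insert (by simp [hb.1, hb.2]), sum_pair hne.symm] at hsum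
      have := hσ a
      omega
    have hab' : σ.SameCycle a b := by
      rcases hb with rfl | rfl
      · exact sameCycle_iterate σ 1 a
      · have := sameCycle_iterate σ 1 (σ.symm a)
        rw [iterate_one, Equiv.apply_symm_apply] at this
        exact this.symm
    refine hab'.trans (ih ?_)
    obtain ⟨k, -, rfl⟩ := exists_iterate_lt_of_sameCycle hab'
    rwa [minimalPeriod_apply_iterate (mem_periodicPts_perm σ a)]

/-- The fibres of a labelling that cuts the cycles of a permutation along the edges of a 2-factor
are a rounding of the 2-factor. -/
theorem IsCut.isRounding (h : IsCut c σ lab) (hx : IsTwoFactor c x) (hσ : ∀ v, x s(v, σ v) ≠ 0)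
    (hP : IsFibers lab P) : IsRounding c x P := by
  have hne : ∀ v, σ v ≠ v := fun v => (adj_supportGraph_perm hx hσ v).ne'
  have hcol : ∀ v, c v ≠ c (σ v) := fun v => hx.1 _ (hσ v)
  have hcases : ∀ p ∈ P.parts, (∃ r, IsCutAt c σ lab r ∧ Odd (minimalPeriod σ r) ∧
      p = {σ.symm r, r, σ r}) ∨ ∃ u, p = {u, σ u} := by
    intro p hp
    obtain ⟨v, hv⟩ := P.nonempty_of_mem_parts hp
    obtain ⟨r, k, hk, hr⟩ := h v
    rcases hP.part_cases h hp hr hv (hk ▸ sameCycle_iterate σ k r) (hne r) with ⟨h1, h2⟩ | h1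
    · exact Or.inl ⟨r, hr, h1, h2⟩
    · exact Or.inr h1
  refine ⟨fun p hp => ?_, fun K => ?_⟩
  · rcases hcases p hp with ⟨r, hr, hodd, rfl⟩ | ⟨u, rfl⟩
    · right
      have h1 := hσ (σ.symm r)
      have h2 := hcol (σ.symm r)
      rw [Equiv.apply_symm_apply] at h1 h2
      exact ⟨σ.symm r, r, σ r, h1, hσ r, h2, hcol r, hr.color hodd, rfl⟩
    · exact Or.inl ⟨u, σ u, hσ u, rfl⟩
  · classical
    set S : Finset (Finset V) := {p ∈ P.parts | (p : Set V) ⊆ K.supp} with hS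
    set T : Finset (Finset V) := {p ∈ S | #p = 3} with hT
    have hTset : {p : Finset V | p ∈ P.parts ∧ #p = 3 ∧ (p : Set V) ⊆ K.supp} = (T : Set (Finset V)) := by
      ext p
      simp only [hT, hS, Set.mem_ofPred_eq, coe_filter, mem_filter]
      tauto
    have hK : K.supp = ((S.biUnion id : Finset V) : Set V) := by
      ext v
      simp only [coe_biUnion, id, Set.mem_iUnion, mem_coe, hS, mem_filter, exists_prop]
      constructor
      · intro hv
        obtain ⟨p, hp, hvp⟩ := P.exists_mem (mem_univ v)
        exact ⟨p, ⟨hp, fun u hu => mem_supp_of_sameCycle hx hσ (hP.sameCycle h hp hvp hu) hv⟩, hvp⟩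
      · rintro ⟨p, ⟨-, hp⟩, hv⟩
        exact hp hv
    have hcard : K.supp.ncard = ∑ p ∈ S, #p := by
      rw [hK, Set.ncard_coe_finset, card_biUnion]
      · rfl
      · intro p hp q hq hpq
        exact P.disjoint (mem_filter.1 hp).1 (mem_filter.1 hq).1 hpq
    -- All parts in K have two or three elements, so the number of triples has the parity of |K|. It
    -- remains to exclude more than one triple.
    have hsum : ∑ p ∈ S, #p = 2 * #S + #T := by
      trans ∑ p ∈ S, (2 + if #p = 3 then 1 else 0)
      swap
      · rw [sum_add_distrib, sum_const, smul_eq_mul, mul_comm, ← card_filter]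
      refine sum_congr rfl fun p hp => ?_
      rcases hcases p (mem_filter.1 hp).1 with ⟨r, hr, hodd, rfl⟩ | ⟨u, rfl⟩
      · rw [card_symm_triple (hne r) hodd]; rfl
      · rw [card_pair (hne u).symm]; rfl
    -- A triple lies on an odd cycle of σ, which is all of K, and the cutting of a single cycle
    -- produces only the triple around its root.
    have hT1 : #T ≤ 1 := by
      rw [card_le_one]
      have hpair : ∀ u, #({u, σ u} : Finset V) ≠ 3 := fun u => by
        rw [card_pair (hne u).symm]; decide
      intro p hp q hq
      simp only [hT, hS, mem_filter] at hp hq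
      rcases hcases p hp.1.1 with ⟨r, hr, hodd, hpr⟩ | ⟨u, rfl⟩
      · obtain ⟨v, hv⟩ := P.nonempty_of_mem_parts hq.1.1
        have hrK : r ∈ K.supp := hp.1.2 (by simp [hpr])
        rcases hP.part_cases h hq.1.1 hr hv
          (sameCycle_of_mem_supp hx hσ hodd hrK (hq.1.2 hv)) (hne r) with ⟨-, h2⟩ | ⟨u, rfl⟩
        · rw [hpr, h2]
        · exact absurd hq.2 (hpair u)
      · exact absurd hp.2 (hpair u)
    rw [hTset, Set.ncard_coe_finset, hcard, hsum]
    omega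

theorem IsTwoFactor.exists_isRounding (hx : IsTwoFactor c x) :
    ∃ P : Finpartition (univ : Finset V), IsRounding c x P := by
  obtain ⟨σ, hσ⟩ := hx.exists_perm
  obtain ⟨lab, hlab⟩ := exists_isCut (c := c) (σ := σ) fun v =>
    (show c v ≠ c (σ v) from hx.1 _ (hσ v)).symm
  obtain ⟨P, hP⟩ := exists_isFibers lab
  exact ⟨P, hlab.isRounding hx hσ hP⟩

end Rounding

/-! ### The auction algorithm for the assignment problem -/

section Auction

open Finset

/-- The invariant of the auction algorithm after `t` bids: bidder `i` holds the object
`asg i - 1` (none if `asg i = 0`), the objects have the prices `p`, and the complementary slackness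
conditions hold up to an error of `1`. -/
structure AuctionInv (n C : ℕ) (W : ℕ → ℕ → ℕ) (asg p : ℕ → ℕ) (t : ℕ) : Prop where
  le : ∀ i < n, asg i ≤ n
  inj : ∀ i < n, ∀ i' < n, asg i = asg i' → asg i ≠ 0 → i = i'
  slack : ∀ i < n, ∀ j, asg i = j + 1 → ∀ k < n, W i j + p j ≤ W i k + p k + 1
  price : ∀ j < n, p j ≠ 0 → ∃ i < n, asg i = j + 1
  bound : ∀ j < n, p j ≤ C + 1
  progress : (∀ i < n, asg i ≠ 0) ∨ t ≤ ∑ j ∈ range n, p j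

/-! ### Combinatorics of the auction -/

variable {n C : ℕ} {W : ℕ → ℕ → ℕ} {asg p : ℕ → ℕ} {t : ℕ}

theorem auctionInv_zero : AuctionInv n C W (fun _ => 0) (fun _ => 0) 0 :=
  ⟨by simp, by simp, by simp, by simp, by simp, by simp⟩

/-- As long as a bidder has no object, there is an object of price `0`. -/
theorem AuctionInv.exists_price_eq_zero (h : AuctionInv n C W asg p t) {u : ℕ} (hu : u < n)
    (hu0 : asg u = 0) : ∃ k < n, p k = 0 := by
  by_contra! hcon
  -- If all prices were positive, all n objects would have distinct owners among the n - 1 bidders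
  -- other than u.
  choose! f hf hfa using fun j (hj : j < n) => h.price j hj (hcon j hj)
  have hsub : (range n).image f ⊆ (range n).erase u := by
    intro i hi
    obtain ⟨j, hj, rfl⟩ := mem_image.1 hi
    rw [mem_range] at hj
    refine mem_erase.2 ⟨?_, mem_range.2 (hf j hj)⟩
    intro he
    have := hfa j hj
    rw [he, hu0] at this
    omega
  have hc := card_le_card hsub
  rw [card_image_of_injOn, card_erase_of_mem (mem_range.2 hu), card_range] at hc
  · omega
  · intro a ha b hb hab
    simp only [coe_range, Set.mem_Iio] at ha hb
    have h1 := hfa a ha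
    have h2 := hfa b hb
    rw [hab] at h1
    omega

/-- The bidder u takes a cheapest object b, whose price rises by 1. This increment is the slackness
error of the new owner; for the others, rising prices of objects they do not hold only help. -/
theorem AuctionInv.bid (h : AuctionInv n C W asg p t) (hW : ∀ i < n, ∀ j < n, W i j ≤ C) {u b : ℕ}
    (hu : u < n) (hu0 : asg u = 0) (hb : b < n) (hmin : ∀ k < n, W u b + p b ≤ W u k + p k)
    {asg' p' : ℕ → ℕ} (ha : ∀ i < n, asg' i = if i = u then b + 1 else if asg i = b + 1 then 0 else asg i)
    (hp : ∀ j < n, p' j = if j = b then p b + 1 else p j) :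
    AuctionInv n C W asg' p' (t + 1) := by
  have hpp : ∀ k < n, p k ≤ p' k := by
    intro k hk
    rw [hp k hk]
    split_ifs with hkb
    · subst hkb; omega
    · exact le_rfl
  refine ⟨?_, ?_, ?_, ?_, ?_, ?_⟩
  · intro i hi
    rw [ha i hi]
    have := h.le i hi
    split_ifs <;> omega
  · intro i hi i' hi' he hne
    rw [ha i hi] at he hne
    rw [ha i' hi'] at he
    have := h.inj i hi i' hi'
    grind
  · intro i hi j hj k hk
    rw [ha i hi] at hj
    have hk' := hpp k hk
    split_ifs at hj with h1 h2
    · obtain rfl : b = j := by omega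
      subst h1
      rw [hp b hb, if_pos rfl]
      have := hmin k hk
      omega
    · have hjn : j < n := by have := h.le i hi; omega
      have := h.slack i hi j hj k hk
      rw [hp j hjn, if_neg (by omega)]
      omega
  · intro j hj hpj
    by_cases hjb : j = b
    · exact ⟨u, hu, by rw [ha u hu, if_pos rfl, hjb]⟩
    · rw [hp j hj, if_neg hjb] at hpj
      obtain ⟨i, hi, hij⟩ := h.price j hj hpj
      refine ⟨i, hi, ?_⟩
      rw [ha i hi, if_neg (by rintro rfl; omega), if_neg (by omega), hij]
  · intro j hj
    rw [hp j hj]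
    have := h.bound j hj
    split_ifs with hjb
    -- An object k of price 0 was available to u at total cost at most C, so the price of b was at
    -- most C before the bid.
    · obtain ⟨k, hk, hk0⟩ := h.exists_price_eq_zero hu hu0
      have h1 := hmin k hk
      have h2 := hW u hu k hk
      omega
    · exact this
  · right
    have h1 : t ≤ ∑ j ∈ range n, p j := by
      rcases h.progress with h1 | h1
      · exact absurd hu0 (h1 u hu)
      · exact h1
    have h2 : ∑ j ∈ range n, p' j = ∑ j ∈ range n, (p j + if j = b then 1 else 0) := by
      refine sum_congr rfl fun j hj => ?_
      rw [hp j (mem_range.1 hj)]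
      split_ifs with hjb
      · rw [hjb]
      · rfl
    rw [h2, sum_add_distrib, sum_ite_eq', if_pos (mem_range.2 hb)]
    omega

theorem AuctionInv.of_complete (h : AuctionInv n C W asg p t) (hc : ∀ i < n, asg i ≠ 0) (t' : ℕ) :
    AuctionInv n C W asg p t' := { h with progress := Or.inl hc }

/-- If somebody were left out, the prices would sum to at least n(C + 1), although each is at most C
+ 1 and one of them is 0. -/
theorem AuctionInv.complete (h : AuctionInv n C W asg p (n * (C + 1))) : ∀ i < n, asg i ≠ 0 := by
  intro u hu hu0
  have h1 : n * (C + 1) ≤ ∑ j ∈ range n, p j := by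
    rcases h.progress with h1 | h1
    · exact absurd hu0 (h1 u hu)
    · exact h1
  obtain ⟨k, hk, hk0⟩ := h.exists_price_eq_zero hu hu0
  have h2 : ∑ j ∈ range n, p j < ∑ j ∈ range n, (C + 1) :=
    sum_lt_sum (fun j hj => h.bound j (mem_range.1 hj)) ⟨k, mem_range.2 hk, by omega⟩
  rw [sum_const, card_range, smul_eq_mul] at h2
  omega

/-- The permutation found by the auction. -/
theorem AuctionInv.exists_perm (h : AuctionInv n C W asg p (n * (C + 1))) :
    ∃ σ : Equiv.Perm (Fin n), (∀ i : Fin n, asg i = (σ i : ℕ) + 1) ∧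
      ∀ i k : Fin n, W i (σ i) + p (σ i) ≤ W i k + p k + 1 := by
  have hc := h.complete
  let f : Fin n → Fin n := fun i => ⟨asg i - 1, by
    have h1 := h.le i i.2
    have h2 := hc i i.2
    omega⟩
  have hf : ∀ i : Fin n, asg i = (f i : ℕ) + 1 := fun i => by
    have h2 := hc i i.2
    simp only [f]
    omega
  have hinj : Function.Injective f := by
    intro i i' hii
    refine Fin.ext (h.inj i i.2 i' i'.2 ?_ (hc i i.2))
    rw [hf, hf, hii]
  refine ⟨Equiv.ofBijective f (Finite.injective_iff_bijective.1 hinj), hf, fun i k => ?_⟩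
  exact h.slack i i.2 _ (hf i) k k.2

/-- The search for a bidder without object. -/
def findBidder : Cmd :=
  forLoop 1 0 (.ite (.get 4 (.var 1) (.const 0)) .skip (.assign 10 (.var 1)))

/-- The search for the cheapest object for the bidder. -/
def findObject : Cmd :=
  forLoop 2 0 (.ite
    (.lt (.add (.get 3 (.var 10) (.var 2)) (.get 5 (.var 2) (.const 0)))
      (.add (.get 3 (.var 10) (.var 11)) (.get 5 (.var 11) (.const 0))))
    (.assign 11 (.var 2)) .skip)

/-- The former owner loses the object. -/
def evictOwner : Cmd :=
  forLoop 1 0 (.ite (.eq (.get 4 (.var 1) (.const 0)) (.add (.var 11) (.const 1)))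
    (.store 4 (.var 1) (.const 0) (.const 0)) .skip)

/-- One bid of the auction. -/
def auctionStep : Cmd :=
  .seq (.assign 10 (.var 0)) (.seq findBidder (.ite (.lt (.var 10) (.var 0))
    (.seq (.assign 11 (.const 0)) (.seq findObject (.seq evictOwner
      (.seq (.store 4 (.var 10) (.const 0) (.add (.var 11) (.const 1)))
        (.store 5 (.var 11) (.const 0) (.add (.get 5 (.var 11) (.const 0)) (.const 1)))))))
    .skip))

/-- The auction, with a number of bids that is given by the variable `8`. -/
def auction : Cmd := forLoop 9 8 auctionStep

/-! ### Correctness of the auction program -/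

variable {N : ℕ} {s : State}

/-- The initial value n of variable 10 is a sentinel: it survives exactly when every bidder holds an
object. -/
theorem runs_findBidder (hN : s.var 0 ≤ N) (h10 : s.var 10 = s.var 0) :
    Runs N findBidder s fun s' =>
      (s'.var 10 < s.var 0 ∧ s.arr 4 (s'.var 10) 0 = 0) ∨
      (s'.var 10 = s.var 0 ∧ ∀ i < s.var 0, s.arr 4 i 0 ≠ 0) := by
  refine Runs.forLoop (fun k s' => (s'.var 10 < s.var 0 ∧ s.arr 4 (s'.var 10) 0 = 0) ∨
      (s'.var 10 = s.var 0 ∧ ∀ i < k, s.arr 4 i 0 ≠ 0)) hN rfl rfl (by decide) ?_ ?_ ?_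
  · right
    simp [State.setVar, h10]
  · intro k s' hk hki hF hI
    have h4 : s'.arr 4 = s.arr 4 := hF.2 4 rfl
    refine Runs.ite (fun hb => Runs.skip ?_) (fun hb => Runs.assign ?_)
    · simp only [Expr.eval, hki, h4] at hb
      simp only [State.setVar, Nat.reduceEqDiff, if_false]
      rcases hI with hI | ⟨h1, h2⟩
      · exact Or.inl hI
      · refine Or.inr ⟨h1, fun i hi => ?_⟩
        rcases Nat.lt_succ_iff_lt_or_eq.1 hi with hi | rfl
        · exact h2 i hi
        · exact hb
    · simp only [Expr.eval, hki, h4] at hb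
      left
      simp [State.setVar, Expr.eval, hki, hb, hk]
  · intro s' _ hI
    exact hI

theorem runs_findObject (hN : s.var 0 ≤ N) (h11 : s.var 11 = 0) (h0 : 0 < s.var 0) :
    Runs N findObject s fun s' => s'.var 11 < s.var 0 ∧ ∀ k < s.var 0,
      s.arr 3 (s.var 10) (s'.var 11) + s.arr 5 (s'.var 11) 0 ≤
        s.arr 3 (s.var 10) k + s.arr 5 k 0 := by
  refine Runs.forLoop (fun m s' => s'.var 11 < s.var 0 ∧ ∀ k < m,
      s.arr 3 (s.var 10) (s'.var 11) + s.arr 5 (s'.var 11) 0 ≤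
        s.arr 3 (s.var 10) k + s.arr 5 k 0) hN rfl rfl (by decide) ?_ ?_ ?_
  · simp [State.setVar, h11, h0]
  · intro m s' hm hmi hF hI
    have h3 : s'.arr 3 = s.arr 3 := hF.2 3 rfl
    have h5 : s'.arr 5 = s.arr 5 := hF.2 5 rfl
    have h10 : s'.var 10 = s.var 10 := hF.1 10 rfl
    refine Runs.ite (fun hb => Runs.assign ?_) (fun hb => Runs.skip ?_)
    · simp only [Expr.eval, hmi, h3, h5, h10, ne_eq, ite_eq_right_iff, one_ne_zero, imp_false,
        not_not] at hb
      simp only [State.setVar, Expr.eval, Nat.reduceEqDiff, if_false, if_true, hmi]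
      refine ⟨hm, fun k hk => ?_⟩
      rcases Nat.lt_succ_iff_lt_or_eq.1 hk with hk | rfl
      · have := hI.2 k hk
        omega
      · exact le_rfl
    · simp only [Expr.eval, hmi, h3, h5, h10, ite_eq_right_iff, one_ne_zero, imp_false] at hb
      simp only [State.setVar, Nat.reduceEqDiff, if_false]
      refine ⟨hI.1, fun k hk => ?_⟩
      rcases Nat.lt_succ_iff_lt_or_eq.1 hk with hk | rfl
      · exact hI.2 k hk
      · omega
  · intro s' _ hI
    exact hI

theorem runs_evictOwner (hN : s.var 0 ≤ N) :
    Runs N evictOwner s fun s' => ∀ i < s.var 0,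
      s'.arr 4 i 0 = if s.arr 4 i 0 = s.var 11 + 1 then 0 else s.arr 4 i 0 := by
  refine Runs.forLoop (fun m s' => ∀ i, s'.arr 4 i 0 =
      if i < m ∧ s.arr 4 i 0 = s.var 11 + 1 then 0 else s.arr 4 i 0) hN rfl rfl (by decide) ?_ ?_ ?_
  · simp [State.setVar]
  · intro m s' hm hmi hF hI
    have h11 : s'.var 11 = s.var 11 := hF.1 11 rfl
    have hIm := hI m
    simp only [lt_irrefl, false_and, if_false] at hIm
    refine Runs.ite (fun hb => Runs.store ?_) (fun hb => Runs.skip ?_)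
    · simp only [Expr.eval, hmi, h11, hIm, ne_eq, ite_eq_right_iff, one_ne_zero, imp_false,
        not_not] at hb
      intro i
      simp only [State.setVar, State.setArr, Expr.eval, hmi, hI i]
      grind
    · simp only [Expr.eval, hmi, h11, hIm, ite_eq_right_iff, one_ne_zero, imp_false] at hb
      intro i
      simp only [State.setVar, hI i]
      grind
  · intro s' _ hI i hi
    rw [hI i]
    simp [hi]

/-- The auction invariant for the memory state `s`. -/
def AuctionState (n C : ℕ) (W : ℕ → ℕ → ℕ) (s : State) (t : ℕ) : Prop :=
  AuctionInv n C W (fun i => s.arr 4 i 0) (fun j => s.arr 5 j 0) t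

theorem runs_auctionStep (hN : s.var 0 ≤ N) (hW : ∀ i < s.var 0, ∀ j < s.var 0, s.arr 3 i j ≤ C)
    (h : AuctionState (s.var 0) C (s.arr 3) s t) :
    Runs N auctionStep s fun s' => AuctionState (s.var 0) C (s.arr 3) s' (t + 1) := by
  refine Runs.seq (Runs.assign ?_)
  refine Runs.seq ((runs_findBidder (s := s.setVar 10 (s.var 0)) hN rfl).conseq fun s₁ hF₁ h₁ => ?_)
  have e0 : s₁.var 0 = s.var 0 := hF₁.1 0 rfl
  have e3 : s₁.arr 3 = s.arr 3 := hF₁.2 3 rfl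
  have e4 : s₁.arr 4 = s.arr 4 := hF₁.2 4 rfl
  have e5 : s₁.arr 5 = s.arr 5 := hF₁.2 5 rfl
  change (s₁.var 10 < s.var 0 ∧ s.arr 4 (s₁.var 10) 0 = 0) ∨
      (s₁.var 10 = s.var 0 ∧ ∀ i < s.var 0, s.arr 4 i 0 ≠ 0) at h₁
  refine Runs.ite (fun hb => ?_) (fun hb => Runs.skip ?_)
  · have hlt : s₁.var 10 < s.var 0 := by
      simp only [Expr.eval, e0, ne_eq, ite_eq_right_iff, one_ne_zero, imp_false, not_not] at hb
      exact hb
    have hu0 : s.arr 4 (s₁.var 10) 0 = 0 := by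
      rcases h₁ with h₁ | h₁
      · exact h₁.2
      · omega
    refine Runs.seq (Runs.assign ?_)
    refine Runs.seq ((runs_findObject (s := s₁.setVar 11 0) (e0.trans_le hN) rfl
      (by change 0 < s₁.var 0; omega)).conseq fun s₂ hF₂ h₂ => ?_)
    have f0 : s₂.var 0 = s.var 0 := (hF₂.1 0 rfl).trans e0
    have f10 : s₂.var 10 = s₁.var 10 := hF₂.1 10 rfl
    have f4 : s₂.arr 4 = s.arr 4 := (hF₂.2 4 rfl).trans e4
    have f5 : s₂.arr 5 = s.arr 5 := (hF₂.2 5 rfl).trans e5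
    change s₂.var 11 < s₁.var 0 ∧ ∀ k < s₁.var 0,
      s₁.arr 3 (s₁.var 10) (s₂.var 11) + s₁.arr 5 (s₂.var 11) 0 ≤
        s₁.arr 3 (s₁.var 10) k + s₁.arr 5 k 0 at h₂
    rw [e0, e3, e5] at h₂
    refine Runs.seq ((runs_evictOwner (s := s₂) (f0.trans_le hN)).conseq fun s₃ hF₃ h₃ => ?_)
    have g10 : s₃.var 10 = s₁.var 10 := (hF₃.1 10 rfl).trans f10
    have g11 : s₃.var 11 = s₂.var 11 := hF₃.1 11 rfl
    have g5 : s₃.arr 5 = s.arr 5 := (hF₃.2 5 rfl).trans f5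
    rw [f0, f4] at h₃
    refine Runs.seq (Runs.store (Runs.store ?_))
    refine AuctionInv.bid h hW hlt hu0 h₂.1 h₂.2 (fun i hi => ?_) (fun j hj => ?_)
    · simp only [State.setArr, Expr.eval, g10, g11, h₃ i hi]
      simp
    · simp only [State.setArr, Expr.eval, g11, g5]
      simp
  · simp only [Expr.eval, e0, ite_eq_right_iff, one_ne_zero, imp_false] at hb
    have hall : ∀ i < s.var 0, s.arr 4 i 0 ≠ 0 := by
      rcases h₁ with h₁ | h₁
      · exact absurd h₁.1 hb
      · exact h₁.2
    -- Once the assignment is complete, the remaining rounds are idle and the invariant no longer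
    -- demands price growth.
    unfold AuctionState
    rw [e4, e5]
    exact AuctionInv.of_complete h hall _

theorem runs_auction (hN : s.var 0 ≤ N) (hN8 : s.var 8 ≤ N)
    (hW : ∀ i < s.var 0, ∀ j < s.var 0, s.arr 3 i j ≤ C) (h8 : s.var 8 = s.var 0 * (C + 1))
    (h4 : ∀ i, s.arr 4 i 0 = 0) (h5 : ∀ i, s.arr 5 i 0 = 0) :
    Runs N auction s fun s' => AuctionState (s.var 0) C (s.arr 3) s' (s.var 0 * (C + 1)) := by
  refine Runs.forLoop (fun m s' => AuctionState (s.var 0) C (s.arr 3) s' m) hN8 rfl rfl (by decide)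
    ?_ ?_ ?_
  · simp only [AuctionState, State.setVar, h4, h5]
    exact auctionInv_zero
  · intro m s' hm hmi hF hI
    have e0 : s'.var 0 = s.var 0 := hF.1 0 rfl
    have e3 : s'.arr 3 = s.arr 3 := hF.2 3 rfl
    have := runs_auctionStep (N := N) (s := s') (C := C) (t := m) (e0.trans_le hN)
      (by rw [e0, e3]; exact hW) (by rw [e0, e3]; exact hI)
    rw [e0, e3] at this
    exact this.conseq fun s'' _ h => h
  · intro s' _ hI
    rwa [h8] at hI

end Auction

/-! ### The computation of the scaled costs -/

section Costs

open Finset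

/-- The cost of the forbidden pairs, for `n` vertices. -/
def bigCost (n : ℕ) : ℕ := (n + 1) + n * (n * (n + 1))

/-- The entry `(i, k)` of the adjacency matrix with self-loops, as a test. -/
def entryExpr (i k : ℕ) : Expr :=
  .lt (.const 0) (.add (.eq (.var i) (.var k)) (.get 0 (.var i) (.var k)))

/-- The computation of `bigCost` in variable `6` and of the number of bids in variable `8`. -/
def setupBounds : Cmd :=
  .seq (.assign 5 (.add (.var 0) (.const 1))) (.seq (.assign 6 (.var 5))
    (.seq (forLoop 1 0 (forLoop 2 0 (.assign 6 (.add (.var 6) (.var 5)))))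
      (.seq (.assign 8 (.const 0))
        (forLoop 1 0 (.assign 8 (.add (.var 8) (.add (.var 6) (.const 1))))))))

/-- The scaled distance of two vertices. -/
def computeDist : Cmd :=
  .seq (.assign 4 (.const 0)) (forLoop 3 0
    (.ite (.eq (entryExpr 1 3) (entryExpr 2 3)) .skip (.assign 4 (.add (.var 4) (.var 5)))))

/-- The scaled cost of a pair of vertices. -/
def computeCost : Cmd :=
  .seq computeDist
    (.ite (.eq (.get 1 (.var 1) (.const 0)) (.get 1 (.var 2) (.const 0)))
      (.store 3 (.var 1) (.var 2) (.var 6)) (.store 3 (.var 1) (.var 2) (.var 4)))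

/-- The matrix of the scaled costs. -/
def computeCosts : Cmd := forLoop 1 0 (forLoop 2 0 computeCost)

/-- The distance of two rows of the adjacency matrix in array `0`. -/
def rowDist (n : ℕ) (a : ℕ → ℕ → ℕ) (i j : ℕ) : ℕ :=
  ∑ k ∈ range n, if (i = k ∨ a i k ≠ 0) ↔ (j = k ∨ a j k ≠ 0) then 0 else 1

/-- The scaled cost of a pair. -/
def pairCost (n : ℕ) (a : ℕ → ℕ → ℕ) (c : ℕ → ℕ) (i j : ℕ) : ℕ :=
  if c i = c j then bigCost n else rowDist n a i j * (n + 1)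

theorem rowDist_le (n : ℕ) (a : ℕ → ℕ → ℕ) (i j : ℕ) : rowDist n a i j ≤ n := by
  unfold rowDist
  refine (sum_le_card_nsmul _ _ 1 fun k _ => ?_).trans (by simp)
  split_ifs <;> omega

theorem pairCost_le (n : ℕ) (a : ℕ → ℕ → ℕ) (c : ℕ → ℕ) (i j : ℕ) :
    pairCost n a c i j ≤ bigCost n := by
  unfold pairCost
  split_ifs
  · exact le_rfl
  · have h := rowDist_le n a i j
    have h1 : rowDist n a i j * (n + 1) ≤ n * (n + 1) := Nat.mul_le_mul_right _ h
    unfold bigCost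
    rcases Nat.eq_zero_or_pos n with rfl | hn
    · omega
    · have := Nat.le_mul_of_pos_left (n * (n + 1)) hn
      omega

/-! ### Correctness of the cost computation -/

variable {N : ℕ} {s : State}

theorem runs_setupBounds (hN : s.var 0 ≤ N) : Runs N setupBounds s fun s' =>
    s'.var 5 = s.var 0 + 1 ∧ s'.var 6 = bigCost (s.var 0) ∧
      s'.var 8 = s.var 0 * (bigCost (s.var 0) + 1) := by
  set n := s.var 0 with hn
  refine Runs.seq (Runs.assign (Runs.seq (Runs.assign (Runs.seq ?_))))
  -- The machine cannot multiply, so products are accumulated by nested loops of additions.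
  refine Runs.forLoop (fun i s' => s'.var 6 = (n + 1) + i * (n * (n + 1))) hN rfl rfl (by decide)
    ?_ ?_ ?_
  · simp [State.setVar, Expr.eval, hn]
  · intro i s₁ hi hi1 hF hI
    have e0 : s₁.var 0 = n := hF.1 0 rfl
    have e5 : s₁.var 5 = n + 1 := hF.1 5 rfl
    refine Runs.forLoop (fun j s' => s'.var 6 = (n + 1) + i * (n * (n + 1)) + j * (n + 1))
      (e0.trans_le hN) rfl rfl (by decide) ?_ ?_ ?_
    · simp [State.setVar, hI]
    · intro j s₂ hj hj2 hF₂ hI₂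
      have f5 : s₂.var 5 = n + 1 := (hF₂.1 5 rfl).trans e5
      refine Runs.assign ?_
      simp only [State.setVar, Expr.eval, Nat.reduceEqDiff, if_false, if_true, f5, hI₂]
      ring
    · intro s₂ _ hI₂
      simp only [State.setVar, Nat.reduceEqDiff, if_false, hI₂, e0]
      ring
  · intro s₁ hF hI
    have e0 : s₁.var 0 = n := hF.1 0 rfl
    have e5 : s₁.var 5 = n + 1 := hF.1 5 rfl
    have e6 : s₁.var 6 = bigCost n := hI
    refine Runs.seq (Runs.assign ?_)
    refine Runs.forLoop (fun i s' => s'.var 8 = i * (bigCost n + 1)) (e0.trans_le hN) rfl rfl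
      (by decide) ?_ ?_ ?_
    · simp [State.setVar, Expr.eval]
    · intro i s₂ hi hi2 hF₂ hI₂
      have f6 : s₂.var 6 = bigCost n := (hF₂.1 6 rfl).trans e6
      refine Runs.assign ?_
      simp only [State.setVar, Expr.eval, Nat.reduceEqDiff, if_false, if_true, f6, hI₂]
      ring
    · intro s₂ hF₂ hI₂
      refine ⟨(hF₂.1 5 rfl).trans e5, (hF₂.1 6 rfl).trans e6, ?_⟩
      rw [hI₂]
      congr 1

theorem eval_entryExpr_eq (s : State) (i j k : ℕ) :
    (Expr.eq (entryExpr i k) (entryExpr j k)).eval s = 0 ↔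
      ¬ ((s.var i = s.var k ∨ s.arr 0 (s.var i) (s.var k) ≠ 0) ↔
        (s.var j = s.var k ∨ s.arr 0 (s.var j) (s.var k) ≠ 0)) := by
  simp only [Expr.eval, entryExpr]
  grind

theorem runs_computeDist (hN : s.var 0 ≤ N) (h5 : s.var 5 = s.var 0 + 1) :
    Runs N computeDist s fun s' =>
      s'.var 4 = rowDist (s.var 0) (s.arr 0) (s.var 1) (s.var 2) * (s.var 0 + 1) := by
  refine Runs.seq (Runs.assign ?_)
  -- The partial sums are `rowDist` with only the first k columns counted.
  refine Runs.forLoop (fun k s' =>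
    s'.var 4 = rowDist k (s.arr 0) (s.var 1) (s.var 2) * (s.var 0 + 1)) hN rfl rfl (by decide)
    ?_ ?_ ?_
  · simp [State.setVar, Expr.eval, rowDist]
  · intro k s' hk hk3 hF hI
    have e0 : s'.arr 0 = s.arr 0 := hF.2 0 rfl
    have e1 : s'.var 1 = s.var 1 := hF.1 1 rfl
    have e2 : s'.var 2 = s.var 2 := hF.1 2 rfl
    have e5 : s'.var 5 = s.var 0 + 1 := (hF.1 5 rfl).trans h5
    have hs : rowDist (k + 1) (s.arr 0) (s.var 1) (s.var 2) =
        rowDist k (s.arr 0) (s.var 1) (s.var 2) +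
          if (s.var 1 = k ∨ s.arr 0 (s.var 1) k ≠ 0) ↔ (s.var 2 = k ∨ s.arr 0 (s.var 2) k ≠ 0)
          then 0 else 1 := sum_range_succ _ _
    refine Runs.ite (fun hb => Runs.skip ?_) (fun hb => Runs.assign ?_)
    · rw [ne_eq, eval_entryExpr_eq, not_not, hk3, e0, e1, e2] at hb
      simp only [State.setVar, Nat.reduceEqDiff, if_false, hI, hs, if_pos hb, add_zero]
    · rw [eval_entryExpr_eq, hk3, e0, e1, e2] at hb
      simp only [State.setVar, Expr.eval, Nat.reduceEqDiff, if_false, if_true, hI, hs, if_neg hb, e5]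
      ring
  · intro s' _ hI
    exact hI

theorem runs_computeCosts (hN : s.var 0 ≤ N) (h5 : s.var 5 = s.var 0 + 1)
    (h6 : s.var 6 = bigCost (s.var 0)) :
    Runs N computeCosts s fun s' => ∀ i < s.var 0, ∀ j < s.var 0,
      s'.arr 3 i j = pairCost (s.var 0) (s.arr 0) (fun i => s.arr 1 i 0) i j := by
  set n := s.var 0 with hn
  set w := pairCost n (s.arr 0) (fun i => s.arr 1 i 0) with hw
  refine Runs.forLoop (fun m s' => ∀ i < m, ∀ j < n, s'.arr 3 i j = w i j) hN rfl rfl (by decide)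
    ?_ ?_ ?_
  · simp
  · intro m s₁ hm hm1 hF hI
    have e0 : s₁.var 0 = n := hF.1 0 rfl
    refine Runs.forLoop (fun l s' => (∀ i < m, ∀ j < n, s'.arr 3 i j = w i j) ∧
      ∀ j < l, s'.arr 3 m j = w m j) (e0.trans_le hN) rfl rfl (by decide) ?_ ?_ ?_
    · exact ⟨hI, by simp⟩
    · intro l s₂ hl hl2 hF₂ hI₂
      have f0 : s₂.var 0 = n := (hF₂.1 0 rfl).trans e0
      have f1 : s₂.var 1 = m := (hF₂.1 1 rfl).trans hm1
      have f5 : s₂.var 5 = n + 1 := ((hF₂.1 5 rfl).trans (hF.1 5 rfl)).trans h5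
      have f6 : s₂.var 6 = bigCost n := ((hF₂.1 6 rfl).trans (hF.1 6 rfl)).trans h6
      have fa0 : s₂.arr 0 = s.arr 0 := (hF₂.2 0 rfl).trans (hF.2 0 rfl)
      have fa1 : s₂.arr 1 = s.arr 1 := (hF₂.2 1 rfl).trans (hF.2 1 rfl)
      have hd := runs_computeDist (s := s₂) (f0.trans_le hN) (by rw [f5, f0])
      rw [f0, f1, hl2, fa0] at hd
      refine Runs.seq (hd.conseq fun s₃ hF₃ h₃ => ?_)
      have g1 : s₃.var 1 = m := (hF₃.1 1 rfl).trans f1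
      have g2 : s₃.var 2 = l := (hF₃.1 2 rfl).trans hl2
      have g6 : s₃.var 6 = bigCost n := (hF₃.1 6 rfl).trans f6
      have ga1 : s₃.arr 1 = s.arr 1 := (hF₃.2 1 rfl).trans fa1
      have ga3 : s₃.arr 3 = s₂.arr 3 := hF₃.2 3 rfl
      have fin : ∀ v : ℕ, v = w m l →
          (∀ i < m, ∀ j < n, (s₃.setArr 3 m l v).arr 3 i j = w i j) ∧
          ∀ j < l + 1, (s₃.setArr 3 m l v).arr 3 m j = w m j := by
        rintro v rfl
        refine ⟨fun i hi j hj => ?_, fun j hj => ?_⟩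
        · simp only [State.setArr, ga3, true_and]
          rw [if_neg (by omega), hI₂.1 i hi j hj]
        · simp only [State.setArr, ga3, true_and]
          split_ifs with hjl
          · rw [hjl]
          · exact hI₂.2 j (by omega)
      refine Runs.ite (fun hb => Runs.store ?_) (fun hb => Runs.store ?_)
      · simp only [Expr.eval, g1, g2, ga1, ne_eq, ite_eq_right_iff, one_ne_zero, imp_false,
          not_not] at hb
        simp only [Expr.eval, g1, g2]
        refine fin _ ?_
        rw [g6, hw]
        exact (if_pos hb).symm
      · simp only [Expr.eval, g1, g2, ga1, ite_eq_right_iff, one_ne_zero, imp_false] at hb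
        simp only [Expr.eval, g1, g2]
        refine fin _ ?_
        rw [h₃, hw]
        exact (if_neg hb).symm
    · intro s₂ _ hI₂ i hi j hj
      rw [e0] at hI₂
      rcases Nat.lt_succ_iff_lt_or_eq.1 hi with hi | rfl
      · exact hI₂.1 i hi j hj
      · exact hI₂.2 j hj
  · intro s' _ hI
    exact hI

end Costs

/-! ### The rounding program -/

section Labels

open Finset Function

/-- The image of a vertex under the permutation stored in array `4`. -/
def succExpr (e : Expr) : Expr := .sub (.get 4 e (.const 0)) (.const 1)

/-- The length of the cycle of vertex `13` is computed in variable `14`. -/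
def findPeriod : Cmd :=
  .seq (.assign 14 (.const 0)) (.seq (.assign 15 (.var 13)) (forLoop 16 0
    (.seq (.assign 15 (succExpr (.var 15)))
      (.ite (.var 14) .skip
        (.ite (.eq (.var 15) (.var 13)) (.assign 14 (.add (.var 16) (.const 1))) .skip)))))

/-- The middle vertex of a part of three vertices is searched for in variable `17`. -/
def findRoot : Cmd :=
  .seq (.assign 17 (.var 13)) (.seq (.assign 15 (.var 13)) (forLoop 16 0
    (.seq
      (.ite (.eq (.get 1 (.var 15) (.const 0)) (.get 1 (succExpr (succExpr (.var 15))) (.const 0)))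
        .skip (.assign 17 (succExpr (.var 15))))
      (.assign 15 (succExpr (.var 15))))))

/-- The labels of the vertices of a cycle are written to array `2`. -/
def labelCycle : Cmd :=
  .seq (.assign 15 (.var 17)) (.seq (.assign 18 (.const 0)) (.seq (.assign 19 (.var 17))
    (forLoop 16 14 (.seq
      (.ite (.var 18) .skip (.ite (.eq (.add (.var 16) (.const 1)) (.var 14))
        (.assign 19 (.var 17)) (.assign 19 (.var 15))))
      (.seq (.store 2 (.var 15) (.const 0) (.add (.var 19) (.const 1)))
        (.seq (.assign 18 (.sub (.const 1) (.var 18))) (.assign 15 (succExpr (.var 15)))))))))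

/-- The labels of all vertices. -/
def labelAll : Cmd :=
  forLoop 13 0 (.ite (.get 2 (.var 13) (.const 0)) .skip
    (.seq findPeriod (.seq findRoot labelCycle)))

/-! ### Correctness of the rounding program -/

variable {N n : ℕ} {s : State} {σ : Equiv.Perm (Fin n)} {c : Fin n → ℕ}

theorem minimalPeriod_le_card_fin (σ : Equiv.Perm (Fin n)) (v : Fin n) : minimalPeriod σ v ≤ n := by
  have h := card_le_card_of_injOn (s := range (minimalPeriod σ v)) (t := univ) (fun k => σ^[k] v)
    (fun _ _ => mem_univ _) (by
      intro a ha b hb hab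
      rw [coe_range] at ha hb
      exact (iterate_inj_of_lt ha hb).1 hab)
  simpa using h

theorem eval_succExpr {e : Expr} {v : Fin n} (hσ : ∀ i : Fin n, s.arr 4 i 0 = (σ i : ℕ) + 1)
    (he : e.eval s = v) : (succExpr e).eval s = σ v := by
  simp [succExpr, Expr.eval, he, hσ]

theorem runs_findPeriod (hn : s.var 0 = n) (hN : n ≤ N)
    (hσ : ∀ i : Fin n, s.arr 4 i 0 = (σ i : ℕ) + 1) {v : Fin n} (hv : s.var 13 = v) :
    Runs N findPeriod s fun s' => s'.var 14 = minimalPeriod σ v := by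
  refine Runs.seq (Runs.assign (Runs.seq (Runs.assign ?_)))
  have hpos := minimalPeriod_perm_pos σ v
  -- The value 0 of variable 14 means that the walk has not yet returned to v. It returns within n
  -- steps.
  refine Runs.forLoop (fun k s' => s'.var 15 = (σ^[k] v : Fin n) ∧
    s'.var 14 = if minimalPeriod σ v ≤ k then minimalPeriod σ v else 0) (hn.trans_le hN) rfl rfl
    (by decide) ?_ ?_ ?_
  · rw [if_neg (by omega)]
    exact ⟨hv, rfl⟩
  · intro k s' hk hki hF hI
    have e4 : s'.arr 4 = s.arr 4 := hF.2 4 rfl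
    have e13 : s'.var 13 = v := (hF.1 13 rfl).trans hv
    have hstep : (succExpr (.var 15)).eval s' = (σ^[k + 1] v : Fin n) := by
      rw [iterate_succ_apply']
      exact eval_succExpr (by rw [e4]; exact hσ) hI.1
    refine Runs.seq (Runs.assign ?_)
    rw [hstep]
    refine Runs.ite (fun hb => Runs.skip ⟨rfl, ?_⟩) (fun hb => Runs.ite (fun hb' => Runs.assign
      ⟨rfl, ?_⟩) (fun hb' => Runs.skip ⟨rfl, ?_⟩))
    · change s'.var 14 ≠ 0 at hb
      change s'.var 14 = _
      rw [hI.2] at hb ⊢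
      split_ifs at hb ⊢ <;> omega
    · change s'.var 14 = 0 at hb
      simp only [Expr.eval, State.setVar, Nat.reduceEqDiff, if_true, if_false, e13, ne_eq,
        ite_eq_right_iff, one_ne_zero, imp_false, not_not, Fin.val_inj] at hb'
      have h1 : minimalPeriod σ v ≤ k + 1 := IsPeriodicPt.minimalPeriod_le (Nat.succ_pos k) hb'
      simp only [Expr.eval, State.setVar, Nat.reduceEqDiff, if_true, if_false, hki, if_pos h1]
      rw [hI.2] at hb
      split_ifs at hb <;> omega
    · change s'.var 14 = 0 at hb
      change s'.var 14 = _
      simp only [Expr.eval, State.setVar, Nat.reduceEqDiff, if_true, if_false, e13,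
        ite_eq_right_iff, one_ne_zero, imp_false, Fin.val_inj] at hb'
      rw [hb]
      rw [hI.2] at hb
      have h1 : minimalPeriod σ v ≠ k + 1 := fun h => hb' (by rw [← h, iterate_minimalPeriod])
      split_ifs at hb ⊢ <;> omega
  · intro s' _ hI
    have h := hI.2
    change s'.var 14 = if minimalPeriod σ v ≤ s.var 0 then _ else _ at h
    rwa [if_pos (by rw [hn]; exact minimalPeriod_le_card_fin σ v)] at h

/-- Proper colouring is assumed in the postcondition only, because the program must also halt in
time on instances without a fairlet decomposition. Any successful position will do, so later ones
may overwrite earlier ones. -/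
theorem runs_findRoot (hn : s.var 0 = n) (hN : n ≤ N)
    (hσ : ∀ i : Fin n, s.arr 4 i 0 = (σ i : ℕ) + 1) (hc : ∀ i : Fin n, s.arr 1 i 0 = c i)
    {v : Fin n} (hv : s.var 13 = v) :
    Runs N findRoot s fun s' => ∃ r : Fin n, s'.var 17 = r ∧ σ.SameCycle v r ∧
      ((∀ u, c (σ u) ≠ c u) → Odd (minimalPeriod σ r) → c (σ.symm r) ≠ c (σ r)) := by
  refine Runs.seq (Runs.assign (Runs.seq (Runs.assign ?_)))
  refine Runs.forLoop (fun k s' => s'.var 15 = (σ^[k] v : Fin n) ∧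
    ∃ r : Fin n, s'.var 17 = r ∧ σ.SameCycle v r ∧
      ((∃ j < k, c (σ^[j] v) ≠ c (σ (σ (σ^[j] v)))) → c (σ.symm r) ≠ c (σ r)))
    (hn.trans_le hN) rfl rfl (by decide) ?_ ?_ ?_
  · exact ⟨hv, v, hv, Equiv.Perm.SameCycle.refl _ _, by simp⟩
  · intro k s' hk hki hF hI
    have e4 : s'.arr 4 = s.arr 4 := hF.2 4 rfl
    have e1 : s'.arr 1 = s.arr 1 := hF.2 1 rfl
    have hσ' : ∀ i : Fin n, s'.arr 4 i 0 = (σ i : ℕ) + 1 := by rw [e4]; exact hσ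
    have hstep : (succExpr (.var 15)).eval s' = (σ (σ^[k] v) : Fin n) := eval_succExpr hσ' hI.1
    have hstep2 : (succExpr (succExpr (.var 15))).eval s' = (σ (σ (σ^[k] v)) : Fin n) :=
      eval_succExpr hσ' hstep
    obtain ⟨h15, r, hr, hrv, hrc⟩ := hI
    have hcond : (Expr.eq (.get 1 (.var 15) (.const 0))
        (.get 1 (succExpr (succExpr (.var 15))) (.const 0))).eval s' =
        if c (σ^[k] v) = c (σ (σ (σ^[k] v))) then 1 else 0 := by
      change (if s'.arr 1 (s'.var 15) 0 =
        s'.arr 1 ((succExpr (succExpr (.var 15))).eval s') 0 then 1 else 0) = _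
      rw [hstep2, h15, e1, hc, hc]
    refine Runs.seq (Runs.ite (fun hb => Runs.skip (Runs.assign ?_))
      (fun hb => Runs.assign (Runs.assign ?_)))
    · rw [hstep]
      refine ⟨by rw [iterate_succ_apply']; rfl, r, hr, hrv, ?_⟩
      rintro ⟨j, hj, hne⟩
      rcases Nat.lt_succ_iff_lt_or_eq.1 hj with hj | rfl
      · exact hrc ⟨j, hj, hne⟩
      · refine absurd ?_ hne
        rw [hcond] at hb
        simpa using hb
    · have hstep' : (succExpr (.var 15)).eval (s'.setVar 17 (σ (σ^[k] v) : Fin n)) =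
          (σ (σ^[k] v) : Fin n) := hstep
      rw [hstep, hstep']
      refine ⟨by rw [iterate_succ_apply']; rfl, σ (σ^[k] v), rfl, ?_, fun _ => ?_⟩
      · rw [← iterate_succ_apply' (f := σ)]
        exact sameCycle_iterate σ _ v
      · rw [hcond] at hb
        simpa using hb
  · rintro s' _ ⟨-, r, hr, hrv, hrc⟩
    refine ⟨r, hr, hrv, fun hσc hodd => hrc ?_⟩
    obtain ⟨k, -, rfl⟩ := exists_iterate_lt_of_sameCycle hrv
    rw [minimalPeriod_apply_iterate (mem_periodicPts_perm σ v)] at hodd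
    obtain ⟨j, hj, hne⟩ := exists_iterate_color_ne hσc hodd
    refine ⟨j, ?_, hne⟩
    change j < s.var 0
    rw [hn]
    exact hj.trans_le (minimalPeriod_le_card_fin σ v)

theorem runs_labelCycle (hN : n ≤ N) (hσ : ∀ i : Fin n, s.arr 4 i 0 = (σ i : ℕ) + 1) {r : Fin n}
    (hr : s.var 17 = r) (hL : s.var 14 = minimalPeriod σ r) :
    Runs N labelCycle s fun s' =>
      (∀ j < minimalPeriod σ r,
        s'.arr 2 (σ^[j] r : Fin n) 0 = (σ^[cutIndex (minimalPeriod σ r) j] r : Fin n) + 1) ∧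
      ∀ u : Fin n, ¬ σ.SameCycle r u → s'.arr 2 u 0 = s.arr 2 u 0 := by
  set L := minimalPeriod σ r with hLdef
  refine Runs.seq (Runs.assign (Runs.seq (Runs.assign (Runs.seq (Runs.assign ?_)))))
  -- Variable 18 is the parity of the position and variable 19 the name of the current part. The
  -- name is needed at odd positions only, and k < L is required because after the last vertex of an
  -- odd cycle variable 19 holds the root.
  refine Runs.forLoop (fun k s' => s'.var 15 = (σ^[k] r : Fin n) ∧ s'.var 18 = k % 2 ∧
    (k % 2 = 1 → k < L → s'.var 19 = (σ^[k - 1] r : Fin n)) ∧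
    (∀ j < k, s'.arr 2 (σ^[j] r : Fin n) 0 = (σ^[cutIndex L j] r : Fin n) + 1) ∧
    ∀ u : Fin n, ¬ σ.SameCycle r u → s'.arr 2 u 0 = s.arr 2 u 0)
    ?_ rfl rfl (by decide) ?_ ?_ ?_
  · change s.var 14 ≤ N
    rw [hL]
    exact (minimalPeriod_le_card_fin σ r).trans hN
  · exact ⟨hr, rfl, by simp, by simp, fun u _ => rfl⟩
  · rintro k s' hk hki hF ⟨h15, h18, h19, hlab, hrest⟩
    change k < s.var 14 at hk
    rw [hL] at hk
    have e4 : s'.arr 4 = s.arr 4 := hF.2 4 rfl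
    have e14 : s'.var 14 = L := (hF.1 14 rfl).trans hL
    have e17 : s'.var 17 = r := (hF.1 17 rfl).trans hr
    -- The common tail of the three branches, which differ only in how the name of the part is
    -- obtained.
    have main : ∀ s₁ : State, s₁.var 15 = (σ^[k] r : Fin n) → s₁.var 18 = k % 2 →
        s₁.arr = s'.arr → s₁.var 19 = (σ^[cutIndex L k] r : Fin n) →
        Runs N (.seq (.store 2 (.var 15) (.const 0) (.add (.var 19) (.const 1)))
          (.seq (.assign 18 (.sub (.const 1) (.var 18))) (.assign 15 (succExpr (.var 15))))) s₁
          fun s'' => (s''.setVar 16 (k + 1)).var 15 = (σ^[k + 1] r : Fin n) ∧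
            (s''.setVar 16 (k + 1)).var 18 = (k + 1) % 2 ∧
            ((k + 1) % 2 = 1 → k + 1 < L →
              (s''.setVar 16 (k + 1)).var 19 = (σ^[k + 1 - 1] r : Fin n)) ∧
            (∀ j < k + 1, (s''.setVar 16 (k + 1)).arr 2 (σ^[j] r : Fin n) 0 =
              (σ^[cutIndex L j] r : Fin n) + 1) ∧
            ∀ u : Fin n, ¬ σ.SameCycle r u →
              (s''.setVar 16 (k + 1)).arr 2 u 0 = s.arr 2 u 0 := by
      intro s₁ h15' h18' ha h19'
      refine Runs.seq (Runs.store (Runs.seq (Runs.assign (Runs.assign ?_))))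
      simp only [Expr.eval, h15', h19']
      refine ⟨?_, ?_, ?_, ?_, ?_⟩
      · rw [iterate_succ_apply']
        simp [State.setVar, State.setArr, succExpr, Expr.eval, h15', ha, e4, hσ]
      · simp only [State.setVar, State.setArr, Nat.reduceEqDiff, if_true, if_false, h18']
        omega
      · intro hk2 hkL
        simp only [State.setVar, State.setArr, Nat.reduceEqDiff, if_false, h19']
        rw [cutIndex, if_neg (by omega), show 2 * (k / 2) = k + 1 - 1 by omega]
      · intro j hj
        simp only [State.setVar, State.setArr, ha, true_and, and_true, Fin.val_inj]
        by_cases hjk : j = k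
        · rw [if_pos (by rw [hjk]), hjk]
        · rw [if_neg (by rwa [iterate_inj_of_lt (by omega) hk])]
          exact hlab j (by omega)
      · intro u hu
        simp only [State.setVar, State.setArr, ha, true_and, and_true, Fin.val_inj]
        rw [if_neg (by rintro rfl; exact hu (sameCycle_iterate σ k r)), hrest u hu]
    refine Runs.seq (Runs.ite (fun hb => Runs.skip (main s' h15 h18 rfl ?_)) (fun hb =>
      Runs.ite (fun hb' => Runs.assign (main _ h15 h18 rfl ?_))
        (fun hb' => Runs.assign (main _ h15 h18 rfl ?_))))
    · simp only [Expr.eval, h18] at hb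
      rw [h19 (by omega) hk, cutIndex, if_neg (by omega), show 2 * (k / 2) = k - 1 by omega]
    · simp only [Expr.eval, h18] at hb
      simp only [Expr.eval, hki, e14, ne_eq, ite_eq_right_iff, one_ne_zero, imp_false,
        not_not] at hb'
      simp only [State.setVar, Expr.eval, if_true, e17]
      rw [cutIndex, if_pos ⟨hb, hb'⟩, iterate_zero, id]
    · simp only [Expr.eval, h18] at hb
      simp only [Expr.eval, hki, e14, ite_eq_right_iff, one_ne_zero, imp_false] at hb'
      simp only [State.setVar, Expr.eval, if_true, h15]
      rw [cutIndex, if_neg (by omega), show 2 * (k / 2) = k by omega]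
  · rintro s' _ ⟨-, -, -, hlab, hrest⟩
    change ∀ j < s.var 14, _ at hlab
    rw [hL] at hlab
    exact ⟨hlab, hrest⟩

/-- The entries of array `2` are labels, increased by one, that cut the cycle of `v`. -/
def IsLabelled (c : Fin n → ℕ) (σ : Equiv.Perm (Fin n)) (s : State) (v : Fin n) : Prop :=
  ∃ r : Fin n, σ.SameCycle r v ∧
    ((∀ u, c (σ u) ≠ c u) → Odd (minimalPeriod σ r) → c (σ.symm r) ≠ c (σ r)) ∧
    ∀ j < minimalPeriod σ r,
      s.arr 2 (σ^[j] r : Fin n) 0 = (σ^[cutIndex (minimalPeriod σ r) j] r : Fin n) + 1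

theorem IsLabelled.ne_zero {u v : Fin n} (h : IsLabelled c σ s v) (huv : σ.SameCycle v u) :
    s.arr 2 u 0 ≠ 0 := by
  obtain ⟨r, hrv, -, hr⟩ := h
  obtain ⟨j, hj, rfl⟩ := exists_iterate_lt_of_sameCycle (hrv.trans huv)
  rw [hr j hj]
  exact Nat.succ_ne_zero _

theorem runs_labelAll (hn : s.var 0 = n) (hN : n ≤ N)
    (hσ : ∀ i : Fin n, s.arr 4 i 0 = (σ i : ℕ) + 1) (hc : ∀ i : Fin n, s.arr 1 i 0 = c i)
    (h2 : ∀ i, s.arr 2 i 0 = 0) :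
    Runs N labelAll s fun s' => ∃ lab : Fin n → Fin n, (∀ v : Fin n, s'.arr 2 v 0 = (lab v : ℕ) + 1) ∧
      ((∀ u, c (σ u) ≠ c u) → IsCut c σ lab) := by
  -- Cycles are labelled as a whole, and labels are shifted by one so that 0 means unlabelled. A
  -- nonzero entry therefore certifies that the entire cycle of the vertex is finished.
  refine Runs.forLoop (fun m s' => (∀ v : Fin n, s'.arr 2 v 0 ≠ 0 → IsLabelled c σ s' v) ∧
    ∀ v : Fin n, (v : ℕ) < m → s'.arr 2 v 0 ≠ 0) (hn.trans_le hN) rfl rfl (by decide) ?_ ?_ ?_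
  · exact ⟨fun v hv => absurd (h2 v) hv, by simp⟩
  · rintro m s₁ hm hm13 hF ⟨hlab, hdone⟩
    obtain ⟨v, hv⟩ : ∃ v : Fin n, m = v := ⟨⟨m, hn ▸ hm⟩, rfl⟩
    subst hv
    have e0 : s₁.var 0 = n := (hF.1 0 rfl).trans hn
    have e4 : s₁.arr 4 = s.arr 4 := hF.2 4 rfl
    have e1 : s₁.arr 1 = s.arr 1 := hF.2 1 rfl
    rw [← e4] at hσ
    rw [← e1] at hc
    refine Runs.ite (fun hb => Runs.skip ⟨hlab, fun u hu => ?_⟩) (fun hb => ?_)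
    · rcases Nat.lt_succ_iff_lt_or_eq.1 hu with hu | hu
      · exact hdone u hu
      · simp only [Expr.eval, hm13] at hb
        rwa [← hu] at hb
    · simp only [Expr.eval, hm13] at hb
      refine Runs.seq ((runs_findPeriod e0 hN hσ hm13).conseq fun s₂ hF₂ hL => ?_)
      have f0 : s₂.var 0 = n := (hF₂.1 0 rfl).trans e0
      have f13 : s₂.var 13 = v := (hF₂.1 13 rfl).trans hm13
      have f4 : s₂.arr 4 = s₁.arr 4 := hF₂.2 4 rfl
      have f1 : s₂.arr 1 = s₁.arr 1 := hF₂.2 1 rfl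
      have f2 : s₂.arr 2 = s₁.arr 2 := hF₂.2 2 rfl
      refine Runs.seq ((runs_findRoot f0 hN (by rw [f4]; exact hσ) (by rw [f1]; exact hc)
        f13).conseq fun s₃ hF₃ h₃ => ?_)
      obtain ⟨r, hr17, hvr, hrc⟩ := h₃
      have g4 : s₃.arr 4 = s₁.arr 4 := (hF₃.2 4 rfl).trans f4
      have g2 : s₃.arr 2 = s₁.arr 2 := (hF₃.2 2 rfl).trans f2
      have g14 : s₃.var 14 = minimalPeriod σ r := by
        obtain ⟨k, -, rfl⟩ := exists_iterate_lt_of_sameCycle hvr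
        rw [minimalPeriod_apply_iterate (mem_periodicPts_perm σ v)]
        exact (hF₃.1 14 rfl).trans hL
      refine (runs_labelCycle hN (by rw [g4]; exact hσ) hr17 g14).conseq fun s₄ hF₄ h₄ => ?_
      rw [g2] at h₄
      have hnew : ∀ u, σ.SameCycle r u → IsLabelled c σ (s₄.setVar 13 (v + 1)) u :=
        fun u hu => ⟨r, hu, hrc, h₄.1⟩
      refine ⟨fun u hu => ?_, fun u hu => ?_⟩
      · by_cases hru : σ.SameCycle r u
        · exact hnew u hru
        · change s₄.arr 2 u 0 ≠ 0 at hu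
          rw [h₄.2 u hru] at hu
          obtain ⟨q, hqu, hqc, hq⟩ := hlab u hu
          refine ⟨q, hqu, hqc, fun j hj => ?_⟩
          rw [← hq j hj]
          exact h₄.2 _ fun h => hru (h.trans ((sameCycle_iterate σ j q).symm.trans hqu))
      · by_cases hru : σ.SameCycle r u
        · exact (hnew u hru).ne_zero (Equiv.Perm.SameCycle.refl _ _)
        · change s₄.arr 2 u 0 ≠ 0
          rw [h₄.2 u hru]
          rcases Nat.lt_succ_iff_lt_or_eq.1 hu with hu | hu
          · exact hdone u hu
          · exact absurd (Fin.ext hu ▸ hvr.symm) hru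
  · rintro s' _ ⟨hlab, hdone⟩
    have hall : ∀ v : Fin n, s'.arr 2 v 0 ≠ 0 := fun v => hdone v (by rw [hn]; exact v.2)
    have hex : ∀ v : Fin n, ∃ w : Fin n, s'.arr 2 v 0 = (w : ℕ) + 1 := by
      intro v
      obtain ⟨r, hrv, -, hr⟩ := hlab v (hall v)
      obtain ⟨j, hj, rfl⟩ := exists_iterate_lt_of_sameCycle hrv
      exact ⟨_, hr j hj⟩
    choose lab hl using hex
    refine ⟨lab, hl, fun hσc v => ?_⟩
    obtain ⟨r, hrv, hrc, hr⟩ := hlab v (hall v)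
    obtain ⟨k, -, hk⟩ := exists_iterate_lt_of_sameCycle hrv
    refine ⟨r, k, hk, hrc hσc, fun j hj => ?_⟩
    have := hr j hj
    rw [hl] at this
    exact Fin.ext (by omega)

end Labels

/-! ### Optimality of the auction and the main program -/

section Optimality

open Finset

variable {n : ℕ}

/-- For 0/1 rows the distance counts the columns in which they differ. The edge weights are thus
integers, on which the exactness of the auction rests. -/
theorem dist_embedding {G : SimpleGraph (Fin n)} {c : Fin n → ℕ} (u v : Fin n) :
    dist (embedding G u) (embedding G v) = (rowDist n ((inputState G c).arr 0) u v : ℝ) := by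
  classical
  have ha : ∀ i k : Fin n, (inputState G c).arr 0 i k ≠ 0 ↔ G.Adj i k := by
    intro i k
    simp [inputState]
  rw [Subtype.dist_eq, PiLp.dist_eq_of_L1, rowDist, sum_range, Nat.cast_sum]
  refine sum_congr rfl fun k _ => ?_
  simp only [ha, Fin.val_inj]
  have hval : ∀ w : Fin n, (embedding G w).1 k = if w = k ∨ G.Adj w k then (1 : ℝ) else 0 := by
    intro w
    simp [embedding]
  rw [hval, hval]
  by_cases h1 : u = k ∨ G.Adj u k <;> by_cases h2 : v = k ∨ G.Adj v k <;> simp [h1, h2]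

/-- Weak duality: in the sum of the slackness inequalities weighted by y, every price occurs with
total weight m on both sides and cancels, leaving an error of 1 per unit of weight. -/
theorem sum_mul_le_of_slack {W : ℕ → ℕ → ℕ} {p : ℕ → ℕ} {σ : Equiv.Perm (Fin n)}
    (h : ∀ i k : Fin n, W i (σ i) + p (σ i) ≤ W i k + p k + 1) {m : ℕ} {y : Fin n → Fin n → ℕ}
    (hrow : ∀ i, ∑ k, y i k = m) (hcol : ∀ k, ∑ i, y i k = m) :
    m * ∑ i : Fin n, W i (σ i) ≤ (∑ i : Fin n, ∑ k : Fin n, y i k * W i k) + m * n := by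
  have h1 : ∑ i : Fin n, ∑ k : Fin n, y i k * (W i (σ i) + p (σ i)) ≤
      ∑ i : Fin n, ∑ k : Fin n, y i k * (W i k + p k + 1) :=
    sum_le_sum fun i _ => sum_le_sum fun k _ => Nat.mul_le_mul_left _ (h i k)
  have h2 : ∑ i : Fin n, ∑ k : Fin n, y i k * (W i (σ i) + p (σ i)) =
      m * ∑ i : Fin n, W i (σ i) + m * ∑ k : Fin n, p k := by
    simp_rw [← sum_mul, hrow, ← mul_sum, sum_add_distrib, mul_add]
    rw [Equiv.sum_comp σ fun k : Fin n => p k]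
  have h3 : ∑ i : Fin n, ∑ k : Fin n, y i k * (W i k + p k + 1) =
      (∑ i : Fin n, ∑ k : Fin n, y i k * W i k) + m * ∑ k : Fin n, p k + m * n := by
    simp_rw [mul_add, mul_one, sum_add_distrib, hrow]
    congr 1
    · congr 1
      rw [sum_comm]
      simp_rw [← sum_mul, hcol, ← mul_sum]
    · simp [mul_comm]
  omega

/-- The permutation found by the auction avoids the forbidden pairs whenever this is possible. -/
theorem color_ne_of_slack {a : ℕ → ℕ → ℕ} {c : Fin n → ℕ} {c' : ℕ → ℕ} (hc : ∀ i : Fin n, c' i = c i)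
    {p : ℕ → ℕ} {σ τ : Equiv.Perm (Fin n)} (hτ : ∀ v, c (τ v) ≠ c v)
    (h : ∀ i k : Fin n, pairCost n a c' i (σ i) + p (σ i) ≤ pairCost n a c' i k + p k + 1)
    (v : Fin n) : c (σ v) ≠ c v := by
  intro hv
  -- Comparison with the permutation matrix of τ: the cost of σ exceeds that of τ by at most n.
  have h1 := sum_mul_le_of_slack (m := 1) (y := fun i k => if τ i = k then 1 else 0) h (by simp)
    (fun k => by
      simp_rw [← Equiv.eq_symm_apply]
      simp)
  simp only [one_mul, ite_mul, zero_mul, sum_ite_eq, mem_univ, if_true] at h1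
  have h2 : ∑ i : Fin n, pairCost n a c' i (τ i) ≤ ∑ _i : Fin n, n * (n + 1) := by
    refine sum_le_sum fun i _ => ?_
    rw [pairCost, if_neg (by rw [hc, hc]; exact (hτ i).symm)]
    exact Nat.mul_le_mul_right _ (rowDist_le _ _ _ _)
  have h3 : pairCost n a c' v (σ v) ≤ ∑ i : Fin n, pairCost n a c' i (σ i) :=
    single_le_sum (f := fun i : Fin n => pairCost n a c' i (σ i)) (fun _ _ => Nat.zero_le _)
      (mem_univ v)
  rw [pairCost, if_pos (by rw [hc, hc, hv])] at h3
  simp only [sum_const, card_univ, Fintype.card_fin, smul_eq_mul] at h2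
  -- The cost of a single forbidden pair is one more than n · n(n + 1) + n, the maximal cost of τ
  -- plus the error.
  unfold bigCost at h3
  omega

/-- The multiplicities of a competing 2-factor y form a symmetric matrix with row and column sums 2,
so duality applies with m = 2. The error 2n is smaller than one scaled unit of weight counted twice.
-/
theorem isOptimalTwoFactor_of_slack {G : SimpleGraph (Fin n)} {c : Fin n → ℕ} {c' : ℕ → ℕ}
    (hc : ∀ i : Fin n, c' i = c i) {p : ℕ → ℕ} {σ : Equiv.Perm (Fin n)} (hσ : ∀ v, c (σ v) ≠ c v)
    (h : ∀ i k : Fin n, pairCost n ((inputState G c).arr 0) c' i (σ i) + p (σ i) ≤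
      pairCost n ((inputState G c).arr 0) c' i k + p k + 1) :
    IsOptimalTwoFactor c (embedding G) (permFactor σ) := by
  refine ⟨isTwoFactor_permFactor hσ, fun y hy => ?_⟩
  set d : Fin n → Fin n → ℕ := fun i k => rowDist n ((inputState G c).arr 0) i k with hd
  have h1 := sum_mul_le_of_slack (m := 2) (y := fun i k => y s(i, k)) h hy.2 (fun k => by
    simp_rw [Sym2.eq_swap (b := k)]
    exact hy.2 k)
  have hl : ∑ i : Fin n, pairCost n ((inputState G c).arr 0) c' i (σ i) =
      (∑ i, d i (σ i)) * (n + 1) := by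
    rw [sum_mul]
    refine sum_congr rfl fun i _ => ?_
    rw [pairCost, if_neg (by rw [hc, hc]; exact (hσ i).symm)]
  have hr : ∑ i : Fin n, ∑ k : Fin n, y s(i, k) * pairCost n ((inputState G c).arr 0) c' i k =
      (∑ i, ∑ k, y s(i, k) * d i k) * (n + 1) := by
    simp_rw [sum_mul]
    refine sum_congr rfl fun i _ => sum_congr rfl fun k _ => ?_
    by_cases h0 : y s(i, k) = 0
    · simp [h0]
    · have hadj : c i ≠ c k := hy.1 _ h0
      rw [pairCost, if_neg (by rwa [hc, hc]), mul_assoc]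
  rw [hl, hr] at h1
  have hcost : twoFactorCost (embedding G) (permFactor σ) = ((∑ i, d i (σ i) : ℕ) : ℝ) := by
    rw [twoFactorCost_permFactor, Nat.cast_sum]
    exact sum_congr rfl fun i _ => dist_embedding i (σ i)
  have hy2 : 2 * twoFactorCost (embedding G) y = ((∑ i, ∑ k, y s(i, k) * d i k : ℕ) : ℝ) := by
    rw [two_mul_twoFactorCost _ hy]
    push_cast
    exact sum_congr rfl fun i _ => sum_congr rfl fun k _ => by rw [dist_embedding (c := c) i k]
  -- The sum over ordered pairs is twice an integer E. The total error, halved, is then n < n + 1,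
  -- which forces the exact inequality.
  obtain ⟨E, hE⟩ : ∃ E : ℕ, twoFactorCost (embedding G) y = E := by
    have hw : ∀ e : Sym2 (Fin n), ∃ k : ℕ, edgeWeight (embedding G) e = k := by
      intro e
      induction e with
      | _ u v => exact ⟨_, dist_embedding (c := c) u v⟩
    choose w hw using hw
    refine ⟨∑ e, y e * w e, ?_⟩
    simp [twoFactorCost, hw]
  have hE2 : 2 * E = ∑ i, ∑ k, y s(i, k) * d i k := by
    rw [hE] at hy2
    exact_mod_cast hy2
  rw [← hE2] at h1
  rw [hcost, hE]
  norm_cast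
  by_contra! hlt
  have h2 : (E + 1) * (n + 1) ≤ (∑ i, d i (σ i)) * (n + 1) := Nat.mul_le_mul_right _ hlt
  have h3 : (2 * E) * (n + 1) = 2 * (E * (n + 1)) := by ring
  have h4 : (E + 1) * (n + 1) = E * (n + 1) + (n + 1) := by ring
  omega

/-- The program: an optimal 2-factor is found by the auction, and its cycles are cut. -/
def fairletProgram : Cmd :=
  .seq setupBounds (.seq computeCosts (.seq auction labelAll))

/-- The iteration bound covers both the n(`bigCost` n + 1) bids and the loops over vertices. A
fairlet decomposition is needed only to make the permutation found by the auction change all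
colours. -/
theorem runs_fairletProgram (G : SimpleGraph (Fin n)) (c : Fin n → ℕ) :
    Runs (n * (bigCost n + 1) + n) fairletProgram (inputState G c) fun s =>
      (∃ Q : Finpartition (univ : Finset (Fin n)), IsFairletDecomposition (1 / 2) c Q) →
        ∃ (x : Sym2 (Fin n) → ℕ) (P : Finpartition (univ : Finset (Fin n))),
          IsOptimalTwoFactor c (embedding G) x ∧ IsRounding c x P ∧ Outputs s P := by
  set s := inputState G c with hs
  have e0 : s.var 0 = n := rfl
  have hz : ∀ a ≠ 0, a ≠ 1 → ∀ i j, s.arr a i j = 0 := by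
    intro a h0 h1 i j
    simp [hs, inputState, h0, h1]
  have hc : ∀ i : Fin n, s.arr 1 i 0 = c i := by
    intro i
    simp [hs, inputState]
  have hnN : n ≤ n * (bigCost n + 1) + n := Nat.le_add_left _ _
  refine Runs.seq ((runs_setupBounds (s := s) hnN).conseq fun s₁ hF₁ h₁ => ?_)
  rw [e0] at h₁
  obtain ⟨h5, h6, h8⟩ := h₁
  have f0 : s₁.var 0 = n := hF₁.1 0 rfl
  have fa : s₁.arr = s.arr := funext fun a => hF₁.2 a rfl
  refine Runs.seq ((runs_computeCosts (s := s₁) (f0.trans_le hnN) (by rw [h5, f0])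
    (by rw [h6, f0])).conseq fun s₂ hF₂ h₂ => ?_)
  rw [f0, fa] at h₂
  have g0 : s₂.var 0 = n := (hF₂.1 0 rfl).trans f0
  have g8 : s₂.var 8 = n * (bigCost n + 1) := (hF₂.1 8 rfl).trans h8
  have ga : ∀ a ≠ 3, s₂.arr a = s.arr a := by
    intro a ha
    rw [← fa]
    refine hF₂.2 a ?_
    simpa [computeCosts, computeCost, computeDist, forLoop, Cmd.writesArr] using ha
  have hauction := runs_auction (N := n * (bigCost n + 1) + n) (s := s₂) (C := bigCost n)
    (g0.trans_le hnN) (g8.trans_le (Nat.le_add_right _ _))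
    (by rw [g0]; exact fun i hi j hj => (h₂ i hi j hj).trans_le (pairCost_le _ _ _ _ _))
    (by rw [g8, g0]) (fun i => by rw [ga 4 (by decide)]; exact hz 4 (by decide) (by decide) _ _)
    (fun i => by rw [ga 5 (by decide)]; exact hz 5 (by decide) (by decide) _ _)
  rw [g0] at hauction
  refine Runs.seq (hauction.conseq fun s₃ hF₃ h₃ => ?_)
  obtain ⟨σ, hσ, hslack⟩ := h₃.exists_perm
  have k0 : s₃.var 0 = n := (hF₃.1 0 rfl).trans g0
  have k1 : s₃.arr 1 = s.arr 1 := (hF₃.2 1 rfl).trans (ga 1 (by decide))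
  have k2 : s₃.arr 2 = s.arr 2 := (hF₃.2 2 rfl).trans (ga 2 (by decide))
  refine (runs_labelAll k0 hnN hσ (c := c) (by rw [k1]; exact hc)
    (by rw [k2]; exact fun i => hz 2 (by decide) (by decide) _ _)).conseq ?_
  rintro s₄ - ⟨lab, hlab, hcut⟩ ⟨Q, hQ⟩
  obtain ⟨τ, hτ, -⟩ := hQ.exists_perm
  have hslack' : ∀ i k : Fin n,
      pairCost n (s.arr 0) (fun i => s.arr 1 i 0) i (σ i) + s₃.arr 5 (σ i) 0 ≤
        pairCost n (s.arr 0) (fun i => s.arr 1 i 0) i k + s₃.arr 5 k 0 + 1 := by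
    intro i k
    have := hslack i k
    rwa [h₂ i i.2 _ (σ i).2, h₂ i i.2 k k.2] at this
  have hσc := color_ne_of_slack (p := fun j => s₃.arr 5 j 0) hc hτ hslack'
  obtain ⟨P, hP⟩ := exists_isFibers lab
  refine ⟨permFactor σ, P, isOptimalTwoFactor_of_slack (p := fun j => s₃.arr 5 j 0) hc hσc hslack',
    (hcut hσc).isRounding (isTwoFactor_permFactor hσc) (permFactor_self_ne_zero σ) hP, fun u v => ?_⟩
  rw [hP u v, hlab, hlab, Nat.add_right_cancel_iff, Fin.val_inj]

/-- The bound for the number of iterations of the loops, as a polynomial. -/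
noncomputable def iterationPoly : Polynomial ℕ :=
  .X * (((.X + 1) + .X * (.X * (.X + 1))) + 1) + .X

theorem eval_iterationPoly (n : ℕ) : iterationPoly.eval n = n * (bigCost n + 1) + n := by
  simp [iterationPoly, bigCost]

end Optimality

end FairClustering

theorem mainTheorem6 :
    -- The method, in any metric space: an optimal 2-factor exists, every 2-factor can be cut into
    -- fairlets, and whichever optimal 2-factor and whichever way of cutting it is taken, the
    -- resulting decomposition has the claimed properties.
    (∀ (V : Type*) [Fintype V] [DecidableEq V] (κ : Type*) (M : Type*) [PseudoMetricSpace M]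
        (c : V → κ) (φ : V → M),
      ((∃ Q : Finpartition (Finset.univ : Finset V),
          FairClustering.IsFairletDecomposition (1 / 2) c Q) →
        ∃ x : Sym2 V → ℕ, FairClustering.IsOptimalTwoFactor c φ x) ∧
      (∀ x : Sym2 V → ℕ, FairClustering.IsTwoFactor c x →
        ∃ P : Finpartition (Finset.univ : Finset V), FairClustering.IsRounding c x P) ∧
      (∀ (x : Sym2 V → ℕ) (P : Finpartition (Finset.univ : Finset V)),
        FairClustering.IsOptimalTwoFactor c φ x → FairClustering.IsRounding c x P →
          FairClustering.IsGoodDecomposition c φ P)) ∧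
    -- The method is carried out by a polynomial-time algorithm on correlation clustering instances.
    (∃ (A : FairClustering.Cmd) (q : Polynomial ℕ),
      ∀ (n : ℕ) (G : SimpleGraph (Fin n)) (c : Fin n → ℕ),
        ∃ (t : ℕ) (s : FairClustering.State),
          FairClustering.Exec A (FairClustering.inputState G c) t s ∧ t ≤ q.eval n ∧
          ((∃ Q : Finpartition (Finset.univ : Finset (Fin n)),
              FairClustering.IsFairletDecomposition (1 / 2) c Q) →
            ∃ (x : Sym2 (Fin n) → ℕ) (P : Finpartition (Finset.univ : Finset (Fin n))),
              FairClustering.IsOptimalTwoFactor c (FairClustering.embedding G) x ∧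
              FairClustering.IsRounding c x P ∧
              FairClustering.Outputs s P ∧
              FairClustering.IsGoodDecomposition c (FairClustering.embedding G) P)) := by
  refine ⟨fun V _ _ κ M _ c φ => ⟨?_, fun x hx => hx.exists_isRounding,
    fun x P hx hP => hP.isGoodDecomposition φ hx⟩, ?_⟩
  · rintro ⟨Q, hQ⟩
    obtain ⟨σ, hσ, -⟩ := hQ.exists_perm
    exact FairClustering.exists_isOptimalTwoFactor φ ⟨_, FairClustering.isTwoFactor_permFactor hσ⟩
  -- The step bound is a polynomial in the iteration bound, which is itself a polynomial in n.
  · refine ⟨FairClustering.fairletProgram,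
      FairClustering.fairletProgram.timePoly.comp FairClustering.iterationPoly, fun n G c => ?_⟩
    obtain ⟨t, s, he, ht, hs⟩ := FairClustering.runs_fairletProgram G c
    refine ⟨t, s, he, ?_, fun hQ => ?_⟩
    · rwa [Polynomial.eval_comp, FairClustering.eval_iterationPoly,
        FairClustering.Cmd.eval_timePoly]
    · obtain ⟨x, P, hx, hP, hout⟩ := hs hQ
      exact ⟨x, P, hx, hP, hout, hP.isGoodDecomposition _ hx⟩
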